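/- **Setting.** Functions are real-valued and $2\pi$-periodic, $\|\varphi\|_p=\big(\int_0^{2\pi}|\varphi|^p\big)^{1/p}$, $\|f\|_C=\max_t|f(t)|$, and $a_k(f),b_k(f)$ are the Fourier coefficients of $f$. Let $\psi:[1,\infty)\to\mathbb R$ and $\beta\in\mathbb R$. For $1\le p<\infty$, $C^\psi_{\beta,p}$ is the set of continuous $2\pi$-periodic $f$ for which there is $\varphi\in L_p$ with $\|\varphi\|_p\le 1$ whose Fourier series is $$\sum_{k=1}^\infty\frac1{\psi(k)}\Big(a_k(f)\cos\big(kx+\tfrac{\beta\pi}2\big)+b_k(f)\sin\big(kx+\tfrac{\beta\pi}2\big)\Big).$$ For $s>0$, $n\in\mathbb N=\{1,2,\dots\}$ put $$Z^s_{n-1}(f;t)=\frac{a_0(f)}2+\sum_{k=1}^{n-1}\Big(1-\Big(\frac kn\Big)^s\Big)\big(a_k(f)\cos kt+b_k(f)\sin kt\big),$$ $$\mathcal E(C^\psi_{\beta,p};Z^s_{n-1})_C=\sup_{f\in C^\psi_{\beta,p}}\|f-Z^s_{n-1}(f;\cdot)\|_C,\qquad E_n(C^\psi_{\beta,p})_C=\sup_{f\in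 C^\psi_{\beta,p}}\inf_{t_{n-1}}\|f-t_{n-1}\|_C,$$ the infimum being over real trigonometric polynomials $t_{n-1}$ of order at most $n-1$. Let $\mathfrak M$ be the set of positive continuous convex functions $g$ on $[1,\infty)$ with $g(t)\to0$ as $t\to\infty$, and for $g\in\mathfrak M$ put $\alpha(g;t)=\dfrac{g(t)}{t|g'(t+0)|}$. Let $\mathfrak M_C$ be the set of $g\in\mathfrak M$ for which there are $K_1,K_2>0$ with $K_1\le\alpha(g;t)\le K_2$ for all $t\ge1$. A non-negative sequence $(a_k)_{k\ge1}$ belongs to $GM^+$ if there is $A\ge1$ with $a_{n_1}+\sum_{k=n_1}^{m-1}|a_k-a_{k+1}|\le A\,a_m$ for all $1\le n_1\le m$; it belongs to $GA^+$ if there are $\varepsilon>0$ and $K$ with $a_{n_1}n_1^{-\varepsilon}\le K a_{n_2}n_2^{-\varepsilon}$ for all $1\le n_1\le n_2$. Put $g_\delta(t)=\psi(t)t^\delta$; when $g_\delta$ is regarded as a sequence it is $(g_\delta(k))_{k\ge1}$. $A(n)\asymp B(n)$ means that there are constants $K,K'>0$ independent of $n$ with $A(n)\le K B(n)$ and $B(n)\le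 K' A(n)$ for all $n\in\mathbb N$. **Theorem 2.** Let $s>0$, $1\le p<\infty$, $g_{1/p}\in\mathfrak M_C$, $g_{s+1/p}\in GM^+\cap GA^+$ and $\beta\in\mathbb R$. (i) If $1<p<\infty$, $\frac1p+\frac1{p'}=1$, $\sum_{k=1}^\infty\psi^{p'}(k)k^{p'-2}<\infty$ and $\inf_{t\ge1}\alpha(g_{1/p};t)>\frac{p'}2$, then $$E_n(C^\psi_{\beta,p})_C\asymp\mathcal E(C^\psi_{\beta,p};Z^s_{n-1})_C\asymp\psi(n)n^{1/p}.$$ (ii) If $p=1$, $\sum_{k=1}^\infty\psi(k)<\infty$ and $\inf_{t\ge1}\alpha(g_1;t)>1$, then $$E_n(C^\psi_{\beta,1})_C\asymp\mathcal E(C^\psi_{\beta,1};Z^s_{n-1})_C\asymp\psi(n)n.$$ -/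

import Mathlib

open scoped ENNReal NNReal

noncomputable section

namespace ZygmundApprox

/-- Cosine Fourier coefficient `a_k(f)` of a `2π`-periodic function. -/
def fourierCos (f : ℝ → ℝ) (k : ℕ) : ℝ :=
  (1 / Real.pi) * ∫ x in (0 : ℝ)..(2 * Real.pi), f x * Real.cos (k * x)

/-- Sine Fourier coefficient `b_k(f)` of a `2π`-periodic function. -/
def fourierSin (f : ℝ → ℝ) (k : ℕ) : ℝ :=
  (1 / Real.pi) * ∫ x in (0 : ℝ)..(2 * Real.pi), f x * Real.sin (k * x)

/-- The space `L_1` of `2π`-periodic real functions summable on a period. -/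
def L1per : Set (ℝ → ℝ) :=
  {f | Function.Periodic f (2 * Real.pi) ∧
    MeasureTheory.IntegrableOn f (Set.Ioc 0 (2 * Real.pi))}

/-- The trigonometric series `c_0 / 2 + ∑_{k ≥ 1} (c_k cos kx + d_k sin kx)` is the Fourier series
of the summable function `φ`. -/
def IsFourierSeriesOf (c d : ℕ → ℝ) (φ : ℝ → ℝ) : Prop :=
  φ ∈ L1per ∧ fourierCos φ 0 = c 0 ∧
    ∀ k : ℕ, 1 ≤ k → fourierCos φ k = c k ∧ fourierSin φ k = d k

/-- `φ` is a `(ψ, β)`-derivative of `f`: the series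
`∑_{k ≥ 1} (1 / ψ(k)) (a_k(f) cos(kx + βπ/2) + b_k(f) sin(kx + βπ/2))`
is the Fourier series of `φ`. Expanding the shifted cosine and sine gives the coefficients
below; the series has no constant term. -/
def IsPsiBetaDeriv (ψ : ℝ → ℝ) (β : ℝ) (f φ : ℝ → ℝ) : Prop :=
  IsFourierSeriesOf
    (fun k => if k = 0 then 0 else
      (1 / ψ k) * (fourierCos f k * Real.cos (β * Real.pi / 2)
        + fourierSin f k * Real.sin (β * Real.pi / 2)))
    (fun k =>
      (1 / ψ k) * (fourierSin f k * Real.cos (β * Real.pi / 2)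
        - fourierCos f k * Real.sin (β * Real.pi / 2)))
    φ

/-- The class `L^ψ_β 𝔑` of summable functions having a `(ψ, β)`-derivative in `𝔑`. -/
def classL (ψ : ℝ → ℝ) (β : ℝ) (N : Set (ℝ → ℝ)) : Set (ℝ → ℝ) :=
  {f | f ∈ L1per ∧ ∃ φ ∈ N, IsPsiBetaDeriv ψ β f φ}

/-- The unit ball `U_p` of the space `L_p` of `2π`-periodic functions, with the norm
`(∫_0^{2π} |φ|^p)^{1/p}`. -/
def unitBall (p : ℝ) : Set (ℝ → ℝ) :=
  {φ | Function.Periodic φ (2 * Real.pi) ∧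
    MeasureTheory.MemLp φ (ENNReal.ofReal p)
      (MeasureTheory.volume.restrict (Set.Ioc 0 (2 * Real.pi))) ∧
    MeasureTheory.eLpNorm φ (ENNReal.ofReal p)
      (MeasureTheory.volume.restrict (Set.Ioc 0 (2 * Real.pi))) ≤ 1}

/-- The class `C^ψ_{β,p}`: the continuous functions of `L^ψ_β U_p`. -/
def classC (ψ : ℝ → ℝ) (β p : ℝ) : Set (ℝ → ℝ) :=
  {f | f ∈ classL ψ β (unitBall p) ∧ Continuous f}

/-- The uniform norm, with values in `[0, ∞]`. -/
def normC (f : ℝ → ℝ) : ℝ≥0∞ := ⨆ x : ℝ, ENNReal.ofReal |f x|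

/-- Real trigonometric polynomials of order `n - 1` (for `n ≥ 1`). -/
def trigPoly (n : ℕ) : Set (ℝ → ℝ) :=
  {t | ∃ c d : ℕ → ℝ, ∀ x : ℝ, t x = c 0 / 2 +
    ∑ k ∈ Finset.Ico 1 n, (c k * Real.cos (k * x) + d k * Real.sin (k * x))}

/-- The Zygmund sum `Z^s_{n-1}(f; x)` (for `n ≥ 1`). -/
def zygmundSum (s : ℝ) (n : ℕ) (f : ℝ → ℝ) (x : ℝ) : ℝ :=
  fourierCos f 0 / 2 + ∑ k ∈ Finset.Ico 1 n,
    (1 - ((k : ℝ) / n) ^ s) *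
      (fourierCos f k * Real.cos (k * x) + fourierSin f k * Real.sin (k * x))

/-- Best uniform approximation `E_n(F)_C` of a class `F` by trigonometric polynomials of
order `n - 1`. -/
def bestApprox (F : Set (ℝ → ℝ)) (n : ℕ) : ℝ≥0∞ :=
  ⨆ f ∈ F, ⨅ t ∈ trigPoly n, normC (fun x => f x - t x)

/-- The uniform deviation `𝓔(F; Z^s_{n-1})_C` of the Zygmund sums on a class `F`. -/
def zygmundDev (F : Set (ℝ → ℝ)) (s : ℝ) (n : ℕ) : ℝ≥0∞ :=
  ⨆ f ∈ F, normC (fun x => f x - zygmundSum s n f x)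

/-- `A(n) = O(B(n))`, `n ∈ {1, 2, …}`, with a finite constant. -/
def BigO (A B : ℕ → ℝ≥0∞) : Prop :=
  ∃ K : ℝ≥0, 0 < K ∧ ∀ n : ℕ, 1 ≤ n → A n ≤ K * B n

/-- `A(n) ≍ B(n)`. -/
def OrderEq (A B : ℕ → ℝ≥0∞) : Prop := BigO A B ∧ BigO B A

/-- The set `𝔐` of positive continuous convex functions on `[1, ∞)` tending to zero. -/
def MM : Set (ℝ → ℝ) :=
  {g | (∀ t : ℝ, 1 ≤ t → 0 < g t) ∧ ContinuousOn g (Set.Ici 1) ∧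
    ConvexOn ℝ (Set.Ici 1) g ∧ Filter.Tendsto g Filter.atTop (nhds 0)}

/-- `α(g; t) = g(t) / (t |g'(t + 0)|)`, with the right derivative of `g`. For `g ∈ 𝔐` and `t ≥ 1`
the right derivative is negative, possibly `-∞` at `t = 1`; in that case the value here is `0`, as
it should be. -/
def alpha (g : ℝ → ℝ) (t : ℝ) : ℝ := g t / (t * |derivWithin g (Set.Ioi t) t|)

/-- The set `𝔐_C`. -/
def MC : Set (ℝ → ℝ) :=
  {g | g ∈ MM ∧ ∃ K₁ K₂ : ℝ, 0 < K₁ ∧ 0 < K₂ ∧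
    ∀ t : ℝ, 1 ≤ t → K₁ ≤ alpha g t ∧ alpha g t ≤ K₂}

/-- `g_δ(t) = ψ(t) t^δ`. -/
def gfun (ψ : ℝ → ℝ) (δ : ℝ) (t : ℝ) : ℝ := ψ t * t ^ δ

/-- Generally monotonically increasing sequences `(a_k)_{k ≥ 1}`. -/
def GMplus : Set (ℕ → ℝ) :=
  {a | (∀ k : ℕ, 1 ≤ k → 0 ≤ a k) ∧ ∃ A : ℝ, 1 ≤ A ∧
    ∀ n₁ n₂ : ℕ, 1 ≤ n₁ → n₁ ≤ n₂ → ∀ m : ℕ, n₁ ≤ m → m ≤ n₂ →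
      a n₁ + ∑ k ∈ Finset.Ico n₁ m, |a k - a (k + 1)| ≤ A * a m}

/-- Almost increasing (in the sense of Bernstein) sequences `(a_k)_{k ≥ 1}`. -/
def AlmostIncreasing (a : ℕ → ℝ) : Prop :=
  (∀ k : ℕ, 1 ≤ k → 0 ≤ a k) ∧ ∃ K : ℝ, ∀ n₁ n₂ : ℕ, 1 ≤ n₁ → n₁ ≤ n₂ → a n₁ ≤ K * a n₂

/-- The set `GA⁺`: for some `ε > 0` the sequence `a_k k^{-ε}` almost increases. -/
def GAplus : Set (ℕ → ℝ) :=
  {a | (∀ k : ℕ, 1 ≤ k → 0 ≤ a k) ∧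
    ∃ ε : ℝ, 0 < ε ∧ AlmostIncreasing (fun k => a k * (k : ℝ) ^ (-ε))}

end ZygmundApprox

end

open scoped ENNReal NNReal

namespace ZygmundApprox

open Real Set Filter MeasureTheory

/-! Everything follows from a cycle of one-sided estimates: the best approximation is at most the
Zygmund deviation, which is at most a constant times `ψ n * n ^ (1 / p)`, which is at most a
constant times the best approximation. The first is immediate, as Zygmund sums are trigonometric
polynomials.

Upper bound. Formally `f - Z f` is the convolution of `φ / π` with the kernel `∑ damp s n k * ψ k *
cos (k u - βπ/2)`, where `damp = min(1, (k/n)^s)`; Fejér's theorem lets one work with finite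
Cesàro-weighted kernels, provided that the bounds do not depend on the truncation `L`. The key
estimate is `damp_mul_psi_le`: with `G = ψ n * n ^ δ` and `δ = 1 / p`, the coefficients are at most
`C G n^(-σ) k^(σ-δ)` for every small `σ` of either sign. Below `n` this comes from `GA⁺`, above `n`
from the upper bound on `α`. One sign is good on one side of the scale `n`, the other on the other
side. For `p = 1` the kernel is bounded by the sum of its coefficients. For `p > 1` Hölder's
inequality asks for its `L_q` norm: Abel summation (`abs_sum_damp_mul_cos_le`) gives `|κ u| ≤ C G
n^(-σ) |u|^(δ-σ-1)`, and one integrates this with `σ = -γ` for `|u| < 1/n` and `σ = γ` beyond.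

Lower bound. Take `φ` to be a normalised Fejér kernel modulated by `cos (2 n x + βπ/2)`. Its
frequencies lie strictly between `n` and `3n`, so the kernel modulated by `cos (2 n x)` annihilates
`trigPoly n`. Pairing `f - t` with it bounds `‖f - t‖_C` from below by a multiple of `κ n ψ(3n)`,
and the lower bound on `α` makes `ψ(3n)` comparable to `ψ(n)`. -/

/-! ### Monotonicity and power-type behaviour of functions in `𝔐`. -/

/-- Convexity puts `g y` below the chord from `x` to a far point `z`; as `z → ∞` the weight at `z`
and `g z` both vanish, leaving `g x`. -/
theorem MM_antitoneOn {g : ℝ → ℝ} (hg : g ∈ MM) : AntitoneOn g (Ici 1) := by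
  obtain ⟨-, -, hconv, hlim⟩ := hg
  intro x hx y hy hxy
  rcases hxy.eq_or_lt with rfl | hlt
  · exact le_rfl
  have hev : ∀ᶠ z in atTop, g y ≤ (1 - (y - x) / (z - x)) * g x + (y - x) / (z - x) * g z := by
    filter_upwards [eventually_gt_atTop y] with z hz
    have hzx : 0 < z - x := by linarith
    have h := hconv.2 hx (show z ∈ Ici (1 : ℝ) from le_trans hy hz.le)
      (show 0 ≤ 1 - (y - x) / (z - x) by rw [sub_nonneg, div_le_one hzx]; linarith)
      (show 0 ≤ (y - x) / (z - x) from div_nonneg (by linarith) hzx.le) (by ring)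
    have he : (1 - (y - x) / (z - x)) • x + ((y - x) / (z - x)) • z = y := by
      simp only [smul_eq_mul]; field_simp; ring
    rw [he] at h
    simpa using h
  have h0 : Tendsto (fun z : ℝ => (y - x) / (z - x)) atTop (nhds 0) :=
    Tendsto.div_atTop tendsto_const_nhds (tendsto_atTop_add_const_right _ (-x) tendsto_id)
  have hl : Tendsto (fun z => (1 - (y - x) / (z - x)) * g x + (y - x) / (z - x) * g z) atTop
      (nhds ((1 - 0) * g x + 0 * 0)) :=
    ((tendsto_const_nhds.sub h0).mul_const _).add (h0.mul hlim)
  have := ge_of_tendsto hl hev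
  simpa using this

/-- Where the right derivative does not exist, `derivWithin` is `0` by default and `alpha` becomes a
division by zero, hence `0`. Positivity of `alpha` therefore carries differentiability. -/
theorem hasDerivWithinAt_of_alpha_pos {g : ℝ → ℝ} {t : ℝ} (h : 0 < alpha g t) :
    HasDerivWithinAt g (derivWithin g (Ioi t) t) (Ici t) t := by
  have h0 : derivWithin g (Ioi t) t ≠ 0 := by
    intro h0
    simp [alpha, h0] at h
  have hd : DifferentiableWithinAt ℝ g (Ioi t) t := by
    by_contra hd
    exact h0 (derivWithin_zero_of_not_differentiableWithinAt hd)
  exact hd.hasDerivWithinAt.Ici_of_Ioi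

theorem MM_derivWithin_nonpos {g : ℝ → ℝ} (hg : g ∈ MM) {t : ℝ} (ht : 1 ≤ t) :
    derivWithin g (Ioi t) t ≤ 0 :=
  ((MM_antitoneOn hg).mono fun _ hx => le_trans ht (le_of_lt hx)).derivWithin_nonpos

/-- Derivative of `log g + c log`. -/
theorem hasDerivWithinAt_log_add {g : ℝ → ℝ} (hg : g ∈ MM) {t : ℝ} (ht : 1 ≤ t)
    (h : 0 < alpha g t) (c : ℝ) :
    HasDerivWithinAt (fun x => log (g x) + c * log x)
      ((c - 1 / alpha g t) / t) (Ici t) t := by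
  have hgt := hg.1 t ht
  have ht0 : 0 < t := by linarith
  have h1 := (hasDerivWithinAt_of_alpha_pos h).log hgt.ne'
  have h2 := ((hasDerivAt_log ht0.ne').hasDerivWithinAt (s := Ici t)).const_mul c
  refine (h1.add h2).congr_deriv ?_
  have hneg := MM_derivWithin_nonpos hg ht
  have h0 : derivWithin g (Ioi t) t ≠ 0 := by
    intro h0
    simp [alpha, h0] at h
  unfold alpha
  rw [abs_of_nonpos hneg]
  field_simp
  ring

theorem continuousOn_log_add {g : ℝ → ℝ} (hg : g ∈ MM) (c a b : ℝ) (ha : 1 ≤ a) :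
    ContinuousOn (fun x => log (g x) + c * log x) (Icc a b) := by
  have hsub : Icc a b ⊆ Ici (1 : ℝ) := fun x hx => le_trans ha hx.1
  refine ContinuousOn.add ((hg.2.1.mono hsub).log fun x hx => (hg.1 x (hsub hx)).ne') ?_
  refine continuousOn_const.mul (continuousOn_log.mono fun x hx => ?_)
  have : (1 : ℝ) ≤ x := hsub hx
  simp only [mem_compl_iff, mem_singleton_iff]
  linarith

theorem exp_log_add {g : ℝ → ℝ} (hg : g ∈ MM) {t : ℝ} (ht : 1 ≤ t) (c : ℝ) :
    exp (log (g t) + c * log t) = g t * t ^ c := by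
  rw [exp_add, exp_log (hg.1 t ht), rpow_def_of_pos (by linarith), mul_comm c]

/-- The logarithm of `g t * t ^ c` has right derivative `(c - 1 / α) / t`, nonpositive once `α ≤ K`
and `c ≤ 1 / K`. Only one-sided derivatives are available, hence the mean value inequality for right
derivatives. -/
theorem MM_mul_rpow_antitone {g : ℝ → ℝ} (hg : g ∈ MM) {K : ℝ}
    (h : ∀ t, 1 ≤ t → 0 < alpha g t ∧ alpha g t ≤ K) {c : ℝ} (hc : c ≤ 1 / K) {a b : ℝ}
    (ha : 1 ≤ a) (hab : a ≤ b) :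
    g b * b ^ c ≤ g a * a ^ c := by
  have key := image_le_of_deriv_right_le_deriv_boundary (continuousOn_log_add hg c a b ha)
    (fun x hx => hasDerivWithinAt_log_add hg (le_trans ha hx.1) (h x (le_trans ha hx.1)).1 c)
    (B := fun _ => log (g a) + c * log a) (B' := fun _ => 0) le_rfl continuousOn_const
    (fun x _ => hasDerivWithinAt_const _ _ _)
    (fun x hx => by
      have hx1 : 1 ≤ x := le_trans ha hx.1
      have := h x hx1
      refine div_nonpos_of_nonpos_of_nonneg ?_ (by linarith)
      have h1 : 1 / K ≤ 1 / alpha g x := one_div_le_one_div_of_le this.1 this.2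
      linarith) (right_mem_Icc.2 hab)
  have := exp_le_exp.2 key
  rwa [exp_log_add hg (ha.trans hab), exp_log_add hg ha] at this

theorem MM_mul_rpow_monotone {g : ℝ → ℝ} (hg : g ∈ MM) {K : ℝ} (hK : 0 < K)
    (h : ∀ t, 1 ≤ t → K ≤ alpha g t) {a b : ℝ} (ha : 1 ≤ a) (hab : a ≤ b) :
    g a * a ^ (1 / K) ≤ g b * b ^ (1 / K) := by
  have key := image_le_of_deriv_right_le_deriv_boundary
    (f := fun _ => log (g a) + 1 / K * log a) (f' := fun _ => 0)
    (B := fun x => log (g x) + 1 / K * log x) (B' := fun x => (1 / K - 1 / alpha g x) / x)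
    continuousOn_const
    (fun x _ => hasDerivWithinAt_const _ _ _) le_rfl
    (continuousOn_log_add hg (1 / K) a b ha)
    (fun x hx => hasDerivWithinAt_log_add hg (le_trans ha hx.1)
      (hK.trans_le (h x (le_trans ha hx.1))) (1 / K))
    (fun x hx => by
      have hx1 : 1 ≤ x := le_trans ha hx.1
      have := h x hx1
      refine div_nonneg ?_ (by linarith)
      have h1 : 1 / alpha g x ≤ 1 / K := one_div_le_one_div_of_le hK this
      linarith) (right_mem_Icc.2 hab)
  have := exp_le_exp.2 key
  rwa [exp_log_add hg (ha.trans hab), exp_log_add hg ha] at this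

theorem psi_eq {ψ : ℝ → ℝ} {δ t : ℝ} (ht : 1 ≤ t) : ψ t = gfun ψ δ t * t ^ (-δ) := by
  have ht0 : 0 < t := by linarith
  rw [gfun, mul_assoc, ← rpow_add ht0]; simp

theorem psi_pos {ψ : ℝ → ℝ} {δ : ℝ} (h : gfun ψ δ ∈ MM) {t : ℝ} (ht : 1 ≤ t) : 0 < ψ t := by
  rw [psi_eq (ψ := ψ) (δ := δ) ht]
  exact mul_pos (h.1 t ht) (rpow_pos_of_pos (by linarith) _)

theorem psi_antitoneOn {ψ : ℝ → ℝ} {δ : ℝ} (hδ : 0 ≤ δ) (h : gfun ψ δ ∈ MM) :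
    AntitoneOn ψ (Ici 1) := by
  intro x hx y hy hxy
  rw [psi_eq (ψ := ψ) (δ := δ) hx, psi_eq (ψ := ψ) (δ := δ) hy]
  have hx0 : (0 : ℝ) < x := lt_of_lt_of_le one_pos hx
  exact mul_le_mul (MM_antitoneOn h hx hy hxy)
    (rpow_le_rpow_of_nonpos hx0 hxy (by linarith)) (rpow_pos_of_pos (by linarith) _).le
    (h.1 x hx).le

/-! ### The damped coefficients. -/

/-- The damping factor `min(1, (k/n)^s)` of the deviation of the Zygmund sums. -/
noncomputable def damp (s : ℝ) (n k : ℕ) : ℝ := min 1 (((k : ℝ) / n) ^ s)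

theorem damp_nonneg (s : ℝ) (n k : ℕ) : 0 ≤ damp s n k :=
  le_min zero_le_one (rpow_nonneg (by positivity) _)

theorem damp_of_le {s : ℝ} (hs : 0 < s) {n k : ℕ} (hn : 1 ≤ n) (h : n ≤ k) : damp s n k = 1 := by
  refine min_eq_left (one_le_rpow ?_ hs.le)
  rw [one_le_div (by exact_mod_cast hn)]
  exact_mod_cast h

theorem damp_of_ge {s : ℝ} (hs : 0 < s) {n k : ℕ} (hn : 1 ≤ n) (h : k ≤ n) :
    damp s n k = ((k : ℝ) / n) ^ s := by
  refine min_eq_right (rpow_le_one (by positivity) ?_ hs.le)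
  rw [div_le_one (by exact_mod_cast hn)]
  exact_mod_cast h

theorem damp_mono {s : ℝ} (hs : 0 < s) (n : ℕ) : Monotone (damp s n) := by
  intro a b hab
  refine min_le_min le_rfl (rpow_le_rpow (by positivity) ?_ hs.le)
  gcongr

theorem damp_succ_sub_le {s : ℝ} (hs : 0 < s) {n : ℕ} (hn : 1 ≤ n) (k : ℕ) :
    damp s n (k + 1) - damp s n k ≤ max s 1 * damp s n (k + 1) / ((k + 1 : ℕ) : ℝ) := by
  rcases le_or_gt n k with h | h
  · rw [damp_of_le hs hn h, damp_of_le hs hn (h.trans k.le_succ), sub_self]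
    positivity
  rw [damp_of_ge hs hn h, damp_of_ge hs hn h.le]
  have hn0 : (0 : ℝ) < n := by exact_mod_cast hn
  have hk0 : (0 : ℝ) < ((k + 1 : ℕ) : ℝ) := by positivity
  set x : ℝ := 1 / ((k + 1 : ℕ) : ℝ) with hx
  have hx0 : 0 < x := by positivity
  have hx1 : x ≤ 1 := by
    rw [hx, div_le_one hk0]; push_cast; linarith [(Nat.cast_nonneg k : (0 : ℝ) ≤ k)]
  have hk : (k : ℝ) / n = ((k + 1 : ℕ) : ℝ) / n * (1 - x) := by
    rw [hx]; field_simp; push_cast; ring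
  rw [hk, mul_rpow (by positivity) (by linarith)]
  -- Bernoulli's inequality for `s ≥ 1`; for `s ≤ 1` simply `1 - x ≤ (1 - x) ^ s`, which explains
  -- `max s 1`.
  have hb : 1 - max s 1 * x ≤ (1 - x) ^ s := by
    rcases le_total 1 s with h1 | h1
    · rw [max_eq_left h1]
      have := one_add_mul_self_le_rpow_one_add (s := -x) (by linarith) h1
      simpa [sub_eq_add_neg] using this
    · rw [max_eq_right h1, one_mul]
      have := rpow_le_rpow_of_exponent_ge' (x := 1 - x) (by linarith) (by linarith) hs.le h1
      simpa using this
  have hP : 0 ≤ (((k + 1 : ℕ) : ℝ) / n) ^ s := by positivity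
  have := mul_le_mul_of_nonneg_left hb hP
  rw [mul_div_assoc, div_eq_mul_one_div ((((k + 1 : ℕ) : ℝ) / n) ^ s), ← hx]
  nlinarith

/-- Both power bounds on the damped coefficients. -/
theorem damp_mul_psi_le {ψ : ℝ → ℝ} {s δ : ℝ} (hs : 0 < s)
    (hMC : gfun ψ δ ∈ MC) (hGA : (fun k : ℕ => gfun ψ (s + δ) k) ∈ GAplus) :
    ∃ γ₀ : ℝ, 0 < γ₀ ∧ ∃ C : ℝ, 0 < C ∧ ∀ σ : ℝ, |σ| ≤ γ₀ → ∀ n k : ℕ, 1 ≤ n → 1 ≤ k →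
      damp s n k * ψ k ≤ C * (ψ n * (n : ℝ) ^ δ) * (n : ℝ) ^ (-σ) * (k : ℝ) ^ (-(δ - σ)) := by
  obtain ⟨hM, K₁, K₂, hK₁, hK₂, hα⟩ := hMC
  obtain ⟨-, ε, hε, -, K, hK⟩ := hGA
  -- `ε` limits `σ` in the range `k ≤ n`, `1 / K₂` in the range `k ≥ n`. The second range needs only
  -- the constant `1`, and `K` is not known to be positive, hence `max K 1`.
  refine ⟨min ε (1 / K₂), by positivity, max K 1, by positivity, fun σ hσ n k hn hk => ?_⟩
  have hσε : |σ| ≤ ε := hσ.trans (min_le_left _ _)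
  have hσK : |σ| ≤ 1 / K₂ := hσ.trans (min_le_right _ _)
  have hn1 : (1 : ℝ) ≤ n := by exact_mod_cast hn
  have hk1 : (1 : ℝ) ≤ k := by exact_mod_cast hk
  have hn0 : (0 : ℝ) < n := by linarith
  have hk0 : (0 : ℝ) < k := by linarith
  have hψn := psi_pos hM hn1
  have hψk := psi_pos hM hk1
  have hG : 0 < ψ n * (n : ℝ) ^ δ := by positivity
  rcases le_total k n with h | h
  · rw [damp_of_ge hs hn h]
    have h1 := hK k n hk h
    simp only [gfun] at h1
    have h2 : ((k : ℝ) / n) ^ s * ψ k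
        = (ψ k * (k : ℝ) ^ (s + δ) * (k : ℝ) ^ (-ε)) * ((n : ℝ) ^ (-s) * (k : ℝ) ^ (ε - δ)) := by
      rw [div_rpow hk0.le hn0.le, rpow_neg hn0.le]
      have : (k : ℝ) ^ s = (k : ℝ) ^ (s + δ) * (k : ℝ) ^ (-ε) * (k : ℝ) ^ (ε - δ) := by
        rw [← rpow_add hk0, ← rpow_add hk0]; ring_nf
      rw [this]; ring
    rw [h2]
    have h3 : K * (ψ n * (n : ℝ) ^ (s + δ) * (n : ℝ) ^ (-ε)) ≤
        max K 1 * (ψ n * (n : ℝ) ^ (s + δ) * (n : ℝ) ^ (-ε)) := by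
      gcongr; exact le_max_left _ _
    calc _ ≤ (max K 1 * (ψ n * (n : ℝ) ^ (s + δ) * (n : ℝ) ^ (-ε))) *
          ((n : ℝ) ^ (-s) * (k : ℝ) ^ (ε - δ)) := by
            refine mul_le_mul_of_nonneg_right (h1.trans h3) (by positivity)
      _ = max K 1 * (ψ n * (n : ℝ) ^ δ) * ((n : ℝ) ^ (-ε) * (k : ℝ) ^ ε) * (k : ℝ) ^ (-δ) := by
          rw [rpow_add hn0, sub_eq_add_neg, rpow_add hk0, rpow_neg hn0.le s]
          field_simp
      _ ≤ max K 1 * (ψ n * (n : ℝ) ^ δ) * ((n : ℝ) ^ (-σ) * (k : ℝ) ^ σ) * (k : ℝ) ^ (-δ) := by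
          gcongr ?_ * ?_ * ?_ * _
          have h4 : ((k : ℝ) / n) ^ ε ≤ ((k : ℝ) / n) ^ σ := by
            refine rpow_le_rpow_of_exponent_ge (by positivity) ?_ ((le_abs_self _).trans hσε)
            rw [div_le_one hn0]; exact_mod_cast h
          rw [div_rpow hk0.le hn0.le, div_rpow hk0.le hn0.le] at h4
          rw [rpow_neg hn0.le, rpow_neg hn0.le, ← div_eq_inv_mul, ← div_eq_inv_mul]
          exact h4
      _ = _ := by
          rw [show -(δ - σ) = σ + -δ by ring, rpow_add hk0]; ring
  · rw [damp_of_le hs hn h, one_mul]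
    have h1 := MM_mul_rpow_antitone hM (fun t ht => ⟨hK₁.trans_le (hα t ht).1, (hα t ht).2⟩)
      (c := -σ) ((neg_le_abs σ).trans hσK) hn1 (show (n : ℝ) ≤ k by exact_mod_cast h)
    simp only [gfun] at h1
    have h2 : ψ k = (ψ k * (k : ℝ) ^ δ * (k : ℝ) ^ (-σ)) * (k : ℝ) ^ (-(δ - σ)) := by
      rw [mul_assoc, mul_assoc, ← rpow_add hk0, ← rpow_add hk0]; ring_nf; simp
    rw [h2]
    refine mul_le_mul_of_nonneg_right (h1.trans ?_) (by positivity)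
    refine mul_le_mul_of_nonneg_right ?_ (by positivity)
    exact le_mul_of_one_le_left hG.le (le_max_right _ _)

/-- A lower doubling bound for `ψ`. -/
theorem psi_three_mul_ge {ψ : ℝ → ℝ} {δ : ℝ} (hMC : gfun ψ δ ∈ MC) :
    ∃ c : ℝ, 0 < c ∧ ∀ n : ℕ, 1 ≤ n → c * ψ n ≤ ψ ((3 * n : ℕ) : ℝ) := by
  obtain ⟨hM, K₁, K₂, hK₁, -, hα⟩ := hMC
  refine ⟨(3 : ℝ) ^ (-(δ + 1 / K₁)), by positivity, fun n hn => ?_⟩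
  have hn1 : (1 : ℝ) ≤ n := by exact_mod_cast hn
  have hn0 : (0 : ℝ) < n := by linarith
  have h := MM_mul_rpow_monotone hM hK₁ (fun t ht => (hα t ht).1) hn1
    (show (n : ℝ) ≤ 3 * n by linarith)
  simp only [gfun] at h
  push_cast
  rw [mul_assoc, mul_assoc, ← rpow_add hn0, ← rpow_add (by positivity),
    mul_rpow (by norm_num) hn0.le] at h
  have h3 : (0 : ℝ) < 3 ^ (δ + 1 / K₁) := by positivity
  have hN : (0 : ℝ) < (n : ℝ) ^ (δ + 1 / K₁) := by positivity
  rw [rpow_neg (by norm_num), inv_mul_le_iff₀ h3]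
  refine le_of_mul_le_mul_right ?_ hN
  linarith

/-! ### Power sums by telescoping, cosine sums by Abel summation. -/

theorem rpow_sub_one_le_sub {c : ℝ} (hc : 0 < c) (hc1 : c ≤ 1) (k : ℕ) :
    ((k + 1 : ℕ) : ℝ) ^ (c - 1) ≤ (((k + 1 : ℕ) : ℝ) ^ c - (k : ℝ) ^ c) / c := by
  have hk0 : (0 : ℝ) < ((k + 1 : ℕ) : ℝ) := by positivity
  have hx1 : 1 / ((k + 1 : ℕ) : ℝ) ≤ 1 := by
    rw [div_le_one hk0]; push_cast; linarith [(Nat.cast_nonneg k : (0 : ℝ) ≤ k)]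
  have hk : (k : ℝ) = ((k + 1 : ℕ) : ℝ) * (1 + -(1 / ((k + 1 : ℕ) : ℝ))) := by
    field_simp; push_cast; ring
  have hb := rpow_one_add_le_one_add_mul_self (s := -(1 / ((k + 1 : ℕ) : ℝ))) (by linarith) hc.le hc1
  have h2 : (k : ℝ) ^ c ≤ ((k + 1 : ℕ) : ℝ) ^ c * (1 + c * -(1 / ((k + 1 : ℕ) : ℝ))) := by
    conv_lhs => rw [hk]
    rw [mul_rpow hk0.le (by linarith)]
    gcongr
  rw [le_div_iff₀ hc, rpow_sub hk0, rpow_one]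
  have : ((k + 1 : ℕ) : ℝ) ^ c * (1 + c * -(1 / ((k + 1 : ℕ) : ℝ)))
    = ((k + 1 : ℕ) : ℝ) ^ c - ((k + 1 : ℕ) : ℝ) ^ c / ((k + 1 : ℕ) : ℝ) * c := by ring
  linarith

theorem rpow_neg_sub_one_le_sub {c : ℝ} (hc : 0 < c) {k : ℕ} (hk1 : 1 ≤ k) :
    ((k + 1 : ℕ) : ℝ) ^ (-c - 1) ≤ ((k : ℝ) ^ (-c) - ((k + 1 : ℕ) : ℝ) ^ (-c)) / c := by
  have hk0 : (0 : ℝ) < k := by exact_mod_cast hk1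
  have hK0 : (0 : ℝ) < ((k + 1 : ℕ) : ℝ) := by positivity
  -- Combines `1 - 1 / y ≤ log y` at `y = (k + 1) / k` with `1 + z ≤ exp z`, which works for every
  -- `c > 0`.
  have hb : 1 + c * (1 / ((k + 1 : ℕ) : ℝ)) ≤ (((k + 1 : ℕ) : ℝ) / k) ^ c := by
    have h1 : 1 - 1 / (((k + 1 : ℕ) : ℝ) / k) ≤ log (((k + 1 : ℕ) : ℝ) / k) := by
      simpa using one_sub_inv_le_log_of_pos (show 0 < ((k + 1 : ℕ) : ℝ) / k by positivity)
    have h2 : 1 - 1 / (((k + 1 : ℕ) : ℝ) / k) = 1 / ((k + 1 : ℕ) : ℝ) := by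
      field_simp; push_cast; ring
    rw [h2] at h1
    rw [rpow_def_of_pos (by positivity)]
    have := add_one_le_exp (log (((k + 1 : ℕ) : ℝ) / k) * c)
    nlinarith
  rw [le_div_iff₀ hc, rpow_sub hK0, rpow_one]
  rw [div_rpow hK0.le hk0.le] at hb
  rw [rpow_neg hk0.le, rpow_neg hK0.le]
  have hA : 0 < ((k + 1 : ℕ) : ℝ) ^ c := by positivity
  have := mul_le_mul_of_nonneg_left hb (inv_nonneg.2 hA.le)
  have e1 : (((k + 1 : ℕ) : ℝ) ^ c)⁻¹ * (((k + 1 : ℕ) : ℝ) ^ c / (k : ℝ) ^ c) = ((k : ℝ) ^ c)⁻¹ := by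
    field_simp
  rw [e1] at this
  have e2 : (((k + 1 : ℕ) : ℝ) ^ c)⁻¹ * (1 + c * (1 / ((k + 1 : ℕ) : ℝ)))
    = (((k + 1 : ℕ) : ℝ) ^ c)⁻¹ + (((k + 1 : ℕ) : ℝ) ^ c)⁻¹ / ((k + 1 : ℕ) : ℝ) * c := by ring
  linarith

theorem sum_rpow_sub_one_le {c : ℝ} (hc : 0 < c) (hc1 : c ≤ 1) (N : ℕ) :
    ∑ k ∈ Finset.Ico 1 (N + 1), (k : ℝ) ^ (c - 1) ≤ (N : ℝ) ^ c / c := by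
  induction N with
  | zero => simp [zero_rpow hc.ne']
  | succ N ih =>
    rw [Finset.sum_Ico_succ_top (by omega)]
    have := rpow_sub_one_le_sub hc hc1 N
    rw [sub_div] at this
    linarith

theorem sum_rpow_neg_sub_one_le {c : ℝ} (hc : 0 < c) {N L : ℕ} (hN : 1 ≤ N) (hNL : N ≤ L) :
    ∑ k ∈ Finset.Ico N L, ((k + 1 : ℕ) : ℝ) ^ (-c - 1) ≤ (N : ℝ) ^ (-c) / c := by
  suffices h : ∑ k ∈ Finset.Ico N L, ((k + 1 : ℕ) : ℝ) ^ (-c - 1)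
      ≤ ((N : ℝ) ^ (-c) - (L : ℝ) ^ (-c)) / c by
    refine h.trans ?_
    gcongr
    exact sub_le_self _ (by positivity)
  induction L, hNL using Nat.le_induction with
  | base => simp
  | succ L hL ih =>
    rw [Finset.sum_Ico_succ_top hL]
    have := rpow_neg_sub_one_le_sub hc (hN.trans hL)
    rw [sub_div] at this ih ⊢
    linarith

theorem two_sin_mul_sum_cos (u θ : ℝ) {N k : ℕ} (h : N ≤ k) :
    2 * sin (u / 2) * ∑ j ∈ Finset.Ico N k, cos (j * u - θ)
      = sin (k * u - u / 2 - θ) - sin (N * u - u / 2 - θ) := by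
  induction k, h using Nat.le_induction with
  | base => simp
  | succ k hk ih =>
    rw [Finset.sum_Ico_succ_top hk, mul_add, ih]
    have e1 : sin (k * u - u / 2 - θ) = sin ((k * u - θ) - u / 2) := by ring_nf
    have e2 : sin (((k + 1 : ℕ) : ℝ) * u - u / 2 - θ) = sin ((k * u - θ) + u / 2) := by
      push_cast; ring_nf
    rw [e1, e2, sin_sub (k * u - θ), sin_add (k * u - θ)]; ring

/-- Multiplying by `2 sin (u / 2)` telescopes the sum to a difference of two sines, and Jordan's
inequality bounds `|sin (u / 2)|` below by `|u| / π`. -/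
theorem abs_sum_cos_le {u : ℝ} (hu : u ≠ 0) (huπ : |u| ≤ π) (θ : ℝ) (N k : ℕ) :
    |∑ j ∈ Finset.Ico N k, cos (j * u - θ)| ≤ π / |u| := by
  have hu0 : 0 < |u| := abs_pos.2 hu
  rcases le_or_gt N k with h | h
  swap
  · rw [Finset.Ico_eq_empty (by omega)]; simp; positivity
  have hs : |u| / π ≤ |sin (u / 2)| := by
    have := mul_abs_le_abs_sin (x := u / 2) (by rw [abs_div, abs_two]; linarith)
    rw [abs_div, abs_two] at this
    calc _ = 2 / π * (|u| / 2) := by ring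
      _ ≤ _ := this
  have h1 := congrArg abs (two_sin_mul_sum_cos u θ h)
  rw [abs_mul, abs_mul, abs_two] at h1
  have h2 : |sin (k * u - u / 2 - θ) - sin (N * u - u / 2 - θ)| ≤ 2 := by
    have := abs_sub (sin (k * u - u / 2 - θ)) (sin (N * u - u / 2 - θ))
    linarith [abs_sin_le_one (k * u - u / 2 - θ), abs_sin_le_one (N * u - u / 2 - θ)]
  rw [← h1] at h2
  rw [le_div_iff₀ hu0]
  have h3 := mul_le_mul_of_nonneg_right hs (abs_nonneg (∑ j ∈ Finset.Ico N k, cos (j * u - θ)))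
  have h4 : |u| / π * |∑ j ∈ Finset.Ico N k, cos (j * u - θ)| ≤ 1 := by linarith
  rw [div_mul_eq_mul_div, div_le_one pi_pos] at h4
  linarith

theorem sum_mul_eq_abel (c z : ℕ → ℝ) {N L : ℕ} (h : N ≤ L) :
    ∑ k ∈ Finset.Ico N L, c k * z k = c L * ∑ j ∈ Finset.Ico N L, z j +
      ∑ k ∈ Finset.Ico N L, (c k - c (k + 1)) * ∑ j ∈ Finset.Ico N (k + 1), z j := by
  induction L, h using Nat.le_induction with
  | base => simp
  | succ L hL ih =>
    rw [Finset.sum_Ico_succ_top hL, Finset.sum_Ico_succ_top hL, ih,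
      Finset.sum_Ico_succ_top hL
        (fun k => (c k - c (k + 1)) * ∑ j ∈ Finset.Ico N (k + 1), z j),
      Finset.sum_Ico_succ_top hL z]
    ring

theorem abs_sum_mul_le_of_partial {c z : ℕ → ℝ} {N L : ℕ} {B : ℝ} (h : N ≤ L) (hc : c L = 0)
    (hB : ∀ k, |∑ j ∈ Finset.Ico N k, z j| ≤ B) :
    |∑ k ∈ Finset.Ico N L, c k * z k| ≤ B * ∑ k ∈ Finset.Ico N L, |c k - c (k + 1)| := by
  rw [sum_mul_eq_abel c z h, hc, zero_mul, zero_add, Finset.mul_sum]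
  refine (Finset.abs_sum_le_sum_abs _ _).trans (Finset.sum_le_sum fun k _ => ?_)
  rw [abs_mul, mul_comm]
  exact mul_le_mul_of_nonneg_right (hB _) (abs_nonneg _)

/-- The sum is split at `N ≈ 1 / |u|`: below, absolute values suffice because `a < 1`; above, cosine
partial sums are at most `π / |u|` and Abel summation leaves the variation of the coefficients,
which is `O(N^(-a))`. The constant does not depend on `L` or `n`. -/
theorem abs_sum_damp_mul_cos_le {s a D : ℝ} (hs : 0 < s) (ha : 0 < a) (ha1 : a < 1) {n : ℕ}
    (hn : 1 ≤ n) {d : ℕ → ℝ} (hd : ∀ k, 1 ≤ k → 0 ≤ d k) (hanti : ∀ k, 1 ≤ k → d (k + 1) ≤ d k)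
    {L : ℕ} (hL : d L = 0) (hD : ∀ k, 1 ≤ k → damp s n k * d k ≤ D * (k : ℝ) ^ (-a))
    {u : ℝ} (hu : u ≠ 0) (huπ : |u| ≤ π) (θ : ℝ) :
    |∑ k ∈ Finset.Ico 1 L, damp s n k * d k * cos (k * u - θ)|
      ≤ (5 / (1 - a) + π * (1 + 2 * max s 1 / a)) * D * |u| ^ (a - 1) := by
  have hu0 : 0 < |u| := abs_pos.2 hu
  have hc0 : ∀ k, 1 ≤ k → 0 ≤ damp s n k * d k := fun k hk => mul_nonneg (damp_nonneg _ _ _) (hd k hk)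
  have hD0 : 0 ≤ D := by simpa using (hc0 1 le_rfl).trans (hD 1 le_rfl)
  obtain ⟨N, hN⟩ : ∃ N : ℕ, N = ⌈1 / |u|⌉₊ := ⟨_, rfl⟩
  have hN1 : 1 ≤ N := by rw [hN, Nat.one_le_ceil_iff]; positivity
  have hN0 : (0 : ℝ) < N := by exact_mod_cast hN1
  have hlow : 1 / |u| ≤ N := by rw [hN]; exact Nat.le_ceil _
  have hup : (N : ℝ) ≤ 5 / |u| := by
    have h1 : (N : ℝ) ≤ 1 / |u| + 1 := by rw [hN]; exact (Nat.ceil_lt_add_one (by positivity)).le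
    -- The `5` is a bound for `1 + π`, since `|u| ≤ π`.
    have h2 : 1 / |u| + 1 ≤ 5 / |u| := by
      rw [div_add_one hu0.ne']; gcongr; linarith [pi_lt_four]
    linarith
  have hfirst : ∀ M, 1 ≤ M → M ≤ N → |∑ k ∈ Finset.Ico 1 M, damp s n k * d k * cos (k * u - θ)|
      ≤ 5 / (1 - a) * D * |u| ^ (a - 1) := by
    intro M hM hMN
    calc _ ≤ ∑ k ∈ Finset.Ico 1 M, D * (k : ℝ) ^ (-a) := by
          refine (Finset.abs_sum_le_sum_abs _ _).trans (Finset.sum_le_sum fun k hk => ?_)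
          have hk1 := (Finset.mem_Ico.1 hk).1
          rw [abs_mul, abs_of_nonneg (hc0 k hk1)]
          exact (mul_le_of_le_one_right (hc0 k hk1) (abs_cos_le_one _)).trans (hD k hk1)
      _ ≤ ∑ k ∈ Finset.Ico 1 (N + 1), D * (k : ℝ) ^ (-a) := by
          refine Finset.sum_le_sum_of_subset_of_nonneg
            (Finset.Ico_subset_Ico le_rfl (by omega)) fun _ _ _ => by positivity
      _ = D * ∑ k ∈ Finset.Ico 1 (N + 1), (k : ℝ) ^ ((1 - a) - 1) := by
          rw [Finset.mul_sum]; ring_nf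
      _ ≤ D * ((N : ℝ) ^ (1 - a) / (1 - a)) := by
          gcongr; exact sum_rpow_sub_one_le (by linarith) (by linarith) N
      _ ≤ D * (5 * |u| ^ (a - 1) / (1 - a)) := by
          have h1a : 0 < 1 - a := by linarith
          gcongr
          calc (N : ℝ) ^ (1 - a) ≤ (5 / |u|) ^ (1 - a) := by gcongr
            _ = 5 ^ (1 - a) * |u| ^ (a - 1) := by
              rw [div_rpow (by norm_num) hu0.le, div_eq_mul_inv, ← rpow_neg hu0.le, neg_sub]
            _ ≤ 5 * |u| ^ (a - 1) := by
              gcongr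
              calc (5 : ℝ) ^ (1 - a) ≤ 5 ^ (1 : ℝ) := by gcongr <;> linarith
                _ = 5 := rpow_one _
      _ = _ := by ring
  have hrest0 : 0 ≤ π * (1 + 2 * max s 1 / a) * D * |u| ^ (a - 1) := by positivity
  rcases Nat.lt_or_ge L 1 with hL1 | hL1
  · rw [Finset.Ico_eq_empty (by omega)]
    have : 0 ≤ 5 / (1 - a) * D * |u| ^ (a - 1) := by
      have h1a : 0 < 1 - a := by linarith
      positivity
    simp only [Finset.sum_empty, abs_zero]; linarith
  rcases le_or_gt L N with hLN | hLN
  · have := hfirst L hL1 hLN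
    linarith
  rw [← Finset.sum_Ico_consecutive _ hN1 hLN.le]
  have h1 := hfirst N hN1 le_rfl
  have h2 : |∑ k ∈ Finset.Ico N L, damp s n k * d k * cos (k * u - θ)|
      ≤ π * (1 + 2 * max s 1 / a) * D * |u| ^ (a - 1) := by
    refine (abs_sum_mul_le_of_partial (c := fun k => damp s n k * d k) hLN.le (by simp [hL])
      (fun k => abs_sum_cos_le hu huπ θ N k)).trans ?_
    have hvar : ∑ k ∈ Finset.Ico N L, |damp s n k * d k - damp s n (k + 1) * d (k + 1)|
        ≤ D * (N : ℝ) ^ (-a) * (1 + 2 * max s 1 / a) := by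
      -- The product of an increasing and a decreasing factor need not be monotone, but `|x - y| ≤
      -- (x - y) + 2 r` when the rise `y - x` is at most `r ≥ 0`. The first part telescopes; only
      -- `damp` contributes to the rise.
      calc _ ≤ ∑ k ∈ Finset.Ico N L, ((damp s n k * d k - damp s n (k + 1) * d (k + 1)) +
            2 * (max s 1 * (D * ((k + 1 : ℕ) : ℝ) ^ (-a - 1)))) := by
            refine Finset.sum_le_sum fun k hk => ?_
            have hk1 := hN1.trans (Finset.mem_Ico.1 hk).1
            have e1 : (damp s n (k + 1) - damp s n k) * d (k + 1)
                ≤ max s 1 * (D * ((k + 1 : ℕ) : ℝ) ^ (-a - 1)) := by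
              calc _ ≤ max s 1 * damp s n (k + 1) / ((k + 1 : ℕ) : ℝ) * d (k + 1) :=
                    mul_le_mul_of_nonneg_right (damp_succ_sub_le hs hn k) (hd _ (by omega))
                _ = max s 1 * (damp s n (k + 1) * d (k + 1) / ((k + 1 : ℕ) : ℝ)) := by ring
                _ ≤ max s 1 * (D * ((k + 1 : ℕ) : ℝ) ^ (-a) / ((k + 1 : ℕ) : ℝ)) := by
                    gcongr ?_ * (?_ / ?_); exact hD _ (by omega)
                _ = _ := by rw [rpow_sub (by positivity), rpow_one]; ring
            have e2 := damp_mono hs n k.le_succ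
            have e3 := mul_nonneg (damp_nonneg s n k) (sub_nonneg.2 (hanti k hk1))
            have e4 := mul_nonneg (sub_nonneg.2 e2) (hd (k + 1) (by omega))
            rw [Nat.succ_eq_add_one] at e4
            rw [abs_le]
            constructor <;> nlinarith
        _ = (damp s n N * d N) + 2 * (max s 1 * (D * ∑ k ∈ Finset.Ico N L,
              ((k + 1 : ℕ) : ℝ) ^ (-a - 1))) := by
            rw [Finset.sum_add_distrib, ← Finset.mul_sum, ← Finset.mul_sum, ← Finset.mul_sum,
              Finset.sum_Ico_eq_sum_range]
            congr 1
            have := Finset.sum_range_sub' (fun i => damp s n (N + i) * d (N + i)) (L - N)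
            simp only [add_zero, Nat.add_sub_cancel' hLN.le, hL, mul_zero, sub_zero] at this
            exact this
        _ ≤ D * (N : ℝ) ^ (-a) + 2 * (max s 1 * (D * ((N : ℝ) ^ (-a) / a))) := by
            refine add_le_add (hD N hN1) ?_
            gcongr
            exact sum_rpow_neg_sub_one_le ha hN1 hLN.le
        _ = _ := by ring
    calc _ ≤ π / |u| * (D * (N : ℝ) ^ (-a) * (1 + 2 * max s 1 / a)) := by gcongr
      _ ≤ π / |u| * (D * |u| ^ a * (1 + 2 * max s 1 / a)) := by
          gcongr
          calc (N : ℝ) ^ (-a) ≤ (1 / |u|) ^ (-a) :=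
                rpow_le_rpow_of_nonpos (by positivity) hlow (by linarith)
            _ = |u| ^ a := by rw [one_div, inv_rpow hu0.le, ← rpow_neg hu0.le, neg_neg]
      _ = _ := by rw [rpow_sub hu0, rpow_one]; ring
  refine (abs_add_le _ _).trans ?_
  linarith

/-! ### The Fejér kernel and Fejér's theorem. -/

/-- The Fejér kernel. -/
noncomputable def fejer (N : ℕ) (x : ℝ) : ℝ :=
  ((∑ i ∈ Finset.range N, cos (i * x)) ^ 2 + (∑ i ∈ Finset.range N, sin (i * x)) ^ 2) / N

theorem fejer_nonneg (N : ℕ) (x : ℝ) : 0 ≤ fejer N x := by unfold fejer; positivity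

theorem continuous_fejer (N : ℕ) : Continuous (fejer N) := by unfold fejer; fun_prop

theorem fejer_mul_eq (N : ℕ) (x : ℝ) :
    (∑ i ∈ Finset.range N, cos (i * x)) ^ 2 + (∑ i ∈ Finset.range N, sin (i * x)) ^ 2
      = N + 2 * ∑ k ∈ Finset.Ico 1 N, ((N : ℝ) - k) * cos (k * x) := by
  induction N with
  | zero => simp
  | succ N ih =>
    have h1 : ∑ k ∈ Finset.Ico 1 (N + 1), (((N + 1 : ℕ) : ℝ) - k) * cos (k * x)
        = ∑ k ∈ Finset.Ico 1 N, ((N : ℝ) - k) * cos (k * x)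
          + ∑ k ∈ Finset.Ico 1 (N + 1), cos (k * x) := by
      have : ∑ k ∈ Finset.Ico 1 N, ((N : ℝ) - k) * cos (k * x)
          = ∑ k ∈ Finset.Ico 1 (N + 1), ((N : ℝ) - k) * cos (k * x) := by
        rcases Nat.eq_zero_or_pos N with rfl | hN
        · simp
        · rw [Finset.sum_Ico_succ_top hN]; simp
      rw [this, ← Finset.sum_add_distrib]
      refine Finset.sum_congr rfl fun k _ => ?_
      push_cast; ring
    -- Substituting `k = N - i` turns the new cosines into exactly the cross terms created when the
    -- two squares are expanded.
    have h2 : ∑ k ∈ Finset.Ico 1 (N + 1), cos (k * x)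
        = cos (N * x) * ∑ i ∈ Finset.range N, cos (i * x)
          + sin (N * x) * ∑ i ∈ Finset.range N, sin (i * x) := by
      rw [Finset.sum_Ico_eq_sum_range, ← Finset.sum_range_reflect, Finset.mul_sum, Finset.mul_sum,
        ← Finset.sum_add_distrib]
      refine Finset.sum_congr (by simp) fun i hi => ?_
      have hi' : i < N := by simpa using hi
      have : ((1 + (N + 1 - 1 - 1 - i) : ℕ) : ℝ) = N - i := by
        rw [show 1 + (N + 1 - 1 - 1 - i) = N - i by omega, Nat.cast_sub hi'.le]
      rw [this, sub_mul, cos_sub]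
    rw [Finset.sum_range_succ, Finset.sum_range_succ, h1, h2]
    have := sin_sq_add_cos_sq (N * x)
    push_cast
    linear_combination ih + this

theorem fejer_eq {N : ℕ} (hN : 1 ≤ N) (x : ℝ) :
    fejer N x = 1 + 2 * ∑ k ∈ Finset.Ico 1 N, (1 - (k : ℝ) / N) * cos (k * x) := by
  have hN0 : (N : ℝ) ≠ 0 := by positivity
  rw [fejer, fejer_mul_eq, add_div, div_self hN0, mul_div_assoc, Finset.sum_div]
  congr 2
  refine Finset.sum_congr rfl fun k _ => ?_
  field_simp

theorem fejer_le_two_mul (N : ℕ) (x : ℝ) : fejer N x ≤ 2 * N := by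
  rcases Nat.eq_zero_or_pos N with rfl | hN
  · simp [fejer]
  have hb : ∀ z : ℕ → ℝ, (∀ i, |z i| ≤ 1) → (∑ i ∈ Finset.range N, z i) ^ 2 ≤ (N : ℝ) ^ 2 := by
    intro z hz
    rw [sq_le_sq, abs_of_nonneg (Nat.cast_nonneg N : (0 : ℝ) ≤ N)]
    refine (Finset.abs_sum_le_sum_abs _ _).trans ((Finset.sum_le_sum fun i _ => hz i).trans ?_)
    simp
  rw [fejer, div_le_iff₀ (by exact_mod_cast hN)]
  have h1 := hb (fun i => cos (i * x)) fun i => abs_cos_le_one _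
  have h2 := hb (fun i => sin (i * x)) fun i => abs_sin_le_one _
  nlinarith

theorem fejer_le_div {N : ℕ} {x : ℝ} (hx : x ≠ 0) (hxπ : |x| ≤ π) :
    fejer N x ≤ 2 * (π / |x|) ^ 2 / N := by
  have h0 : 0 ≤ π / |x| := by positivity
  have h1 := abs_sum_cos_le hx hxπ 0 0 N
  have h2 := abs_sum_cos_le hx hxπ (π / 2) 0 N
  simp only [sub_zero, cos_sub_pi_div_two, Nat.Ico_zero_eq_range] at h1 h2
  rw [fejer]
  gcongr
  have h3 := sq_le_sq' (neg_le_of_abs_le h1) (le_of_abs_le h1)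
  have h4 := sq_le_sq' (neg_le_of_abs_le h2) (le_of_abs_le h2)
  linarith

theorem integral_cos_period {z : ℤ} (hz : z ≠ 0) (a θ : ℝ) :
    ∫ x in a..(a + 2 * π), cos (z * x + θ) = 0 := by
  have hz' : (z : ℝ) ≠ 0 := by exact_mod_cast hz
  rw [intervalIntegral.integral_comp_mul_add (fun x => cos x) hz', integral_cos]
  have : sin (z * (a + 2 * π) + θ) = sin (z * a + θ) := by
    rw [show z * (a + 2 * π) + θ = (z * a + θ) + z * (2 * π) by ring]
    exact sin_add_int_mul_two_pi _ _
  simp [this]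

theorem integral_cos_nat_period {k : ℕ} (hk : 1 ≤ k) (a : ℝ) :
    ∫ x in a..(a + 2 * π), cos (k * x) = 0 := by
  have := integral_cos_period (z := k) (by omega) a 0
  simpa using this

theorem integral_fejer {N : ℕ} (hN : 1 ≤ N) (a : ℝ) :
    ∫ x in a..(a + 2 * π), fejer N x = 2 * π := by
  simp_rw [fejer_eq hN]
  rw [intervalIntegral.integral_add (by simp) (Continuous.intervalIntegrable (by fun_prop) _ _),
    intervalIntegral.integral_const_mul, intervalIntegral.integral_finsetSum
      (fun k _ => Continuous.intervalIntegrable (by fun_prop) _ _)]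
  rw [Finset.sum_eq_zero]
  · simp
  · intro k hk
    rw [intervalIntegral.integral_const_mul, integral_cos_nat_period (Finset.mem_Ico.1 hk).1,
      mul_zero]

/-- The kernels divided by `2π` form an approximate identity: nonnegative, of mass one, and
uniformly small away from `0` by `fejer_le_div`. -/
theorem tendsto_integral_fejer {g : ℝ → ℝ} (hg : Continuous g) :
    Tendsto (fun N : ℕ => (1 / (2 * π)) * ∫ y in (-π)..π, g y * fejer N y) atTop (nhds (g 0)) := by
  have hπ := pi_pos
  have key := tendsto_setIntegral_peak_smul_of_integrableOn_of_tendsto (μ := volume)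
    (s := Ioc (-π) π) (t := Ioc (-π) π) (x₀ := (0 : ℝ)) (l := atTop) (a := g 0) (g := g)
    (φ := fun (N : ℕ) y => fejer N y / (2 * π)) measurableSet_Ioc measurableSet_Ioc le_rfl
    self_mem_nhdsWithin (by simp) (Eventually.of_forall fun N y _ =>
      div_nonneg (fejer_nonneg N y) (by positivity)) ?_ ?_ ?_
    (hg.integrableOn_Ioc) hg.continuousWithinAt
  · refine key.congr fun N => ?_
    rw [intervalIntegral.integral_of_le (by linarith), ← integral_const_mul]
    refine integral_congr_ae (Eventually.of_forall fun y => ?_)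
    simp only [smul_eq_mul]; ring
  · intro u hu h0
    obtain ⟨ε, hε, hball⟩ := Metric.isOpen_iff.1 hu 0 h0
    rw [Metric.tendstoUniformlyOn_iff]
    intro η hη
    have hlim : Tendsto (fun N : ℕ => 2 * (π / ε) ^ 2 / (2 * π) / (N : ℝ)) atTop (nhds 0) :=
      tendsto_const_div_atTop_nhds_zero_nat _
    filter_upwards [hlim.eventually (gt_mem_nhds hη)] with N hN y hy
    have hεy : ε ≤ |y| := by
      by_contra! h
      exact hy.2 (hball (by simpa [Real.dist_eq] using h))
    have hy0 : y ≠ 0 := abs_pos.1 (hε.trans_le hεy)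
    have hyπ : |y| ≤ π := abs_le.2 ⟨hy.1.1.le, hy.1.2⟩
    simp only [Pi.zero_apply, dist_zero_left, Real.norm_eq_abs]
    rw [abs_of_nonneg (div_nonneg (fejer_nonneg N y) (by positivity))]
    refine lt_of_le_of_lt ?_ hN
    calc fejer N y / (2 * π) ≤ (2 * (π / |y|) ^ 2 / N) / (2 * π) := by
          gcongr; exact fejer_le_div hy0 hyπ
      _ ≤ (2 * (π / ε) ^ 2 / N) / (2 * π) := by gcongr
      _ = _ := by ring
  · refine tendsto_const_nhds.congr' ?_
    filter_upwards [eventually_ge_atTop 1] with N hN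
    rw [integral_div, ← intervalIntegral.integral_of_le (by linarith)]
    have := integral_fejer hN (-π)
    rw [show -π + 2 * π = π by ring] at this
    rw [this, div_self (by positivity)]
  · exact Eventually.of_forall fun N => ((continuous_fejer N).div_const _).aestronglyMeasurable

theorem integral_comp_sub_period {h : ℝ → ℝ} (hh : Function.Periodic h (2 * π)) (x : ℝ) :
    ∫ t in (0 : ℝ)..(2 * π), h (x - t) = ∫ u in (-π)..π, h u := by
  rw [intervalIntegral.integral_comp_sub_left, sub_zero]
  have := hh.intervalIntegral_add_eq (x - 2 * π) (-π)
  rw [show x - 2 * π + 2 * π = x by ring, show -π + 2 * π = π by ring] at this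
  exact this

theorem L1per.intervalIntegrable {f : ℝ → ℝ} (hf : f ∈ L1per) :
    IntervalIntegrable f volume 0 (2 * π) := by
  rw [intervalIntegrable_iff_integrableOn_Ioc_of_le (by positivity)]
  exact hf.2

theorem integral_mul_cos_sub {f : ℝ → ℝ} (hf : f ∈ L1per) (k : ℕ) (x θ : ℝ) :
    ∫ t in (0 : ℝ)..(2 * π), f t * cos (k * (x - t) - θ)
      = π * (fourierCos f k * cos (k * x - θ) + fourierSin f k * sin (k * x - θ)) := by
  have hi := L1per.intervalIntegrable hf
  have : ∀ t, f t * cos (k * (x - t) - θ)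
      = f t * cos (k * t) * cos (k * x - θ) + f t * sin (k * t) * sin (k * x - θ) := by
    intro t
    rw [show k * (x - t) - θ = (k * x - θ) - k * t by ring, cos_sub]; ring
  simp_rw [this]
  rw [intervalIntegral.integral_add, intervalIntegral.integral_mul_const,
    intervalIntegral.integral_mul_const, fourierCos, fourierSin]
  · field_simp
  · exact (hi.mul_continuousOn (by fun_prop)).mul_const _
  · exact (hi.mul_continuousOn (by fun_prop)).mul_const _

theorem integral_mul_sum_cos_sub {f : ℝ → ℝ} (hf : f ∈ L1per) (s : Finset ℕ) (c : ℕ → ℝ) (x θ : ℝ) :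
    ∫ t in (0 : ℝ)..(2 * π), f t * ∑ k ∈ s, c k * cos (k * (x - t) - θ)
      = π * ∑ k ∈ s, c k * (fourierCos f k * cos (k * x - θ) + fourierSin f k * sin (k * x - θ)) := by
  have hi := L1per.intervalIntegrable hf
  simp_rw [Finset.mul_sum]
  rw [intervalIntegral.integral_finsetSum]
  · refine Finset.sum_congr rfl fun k _ => ?_
    have : ∀ t, f t * (c k * cos (k * (x - t) - θ)) = c k * (f t * cos (k * (x - t) - θ)) :=
      fun t => by ring
    simp_rw [this]
    rw [intervalIntegral.integral_const_mul, integral_mul_cos_sub hf]; ring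
  · intro k _
    exact hi.mul_continuousOn (by fun_prop)

theorem periodic_sum_cos (s : Finset ℕ) (c : ℕ → ℝ) (θ : ℝ) :
    Function.Periodic (fun u : ℝ => ∑ k ∈ s, c k * cos (k * u - θ)) (2 * π) := by
  intro u
  refine Finset.sum_congr rfl fun k _ => ?_
  rw [show (k : ℝ) * (u + 2 * π) - θ = (k * u - θ) + k * (2 * π) by ring, cos_add_nat_mul_two_pi]

theorem periodic_fejer {N : ℕ} (hN : 1 ≤ N) : Function.Periodic (fejer N) (2 * π) := by
  intro u
  rw [fejer_eq hN, fejer_eq hN]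
  have := periodic_sum_cos (Finset.Ico 1 N) (fun k => 1 - (k : ℝ) / N) 0 u
  simp only [sub_zero] at this
  rw [this]

/-- Fejér's theorem: the Cesàro means of the Fourier series of a continuous periodic function
converge to it. -/
theorem tendsto_fejer_means {f : ℝ → ℝ} (hf : f ∈ L1per) (hc : Continuous f) (x : ℝ) :
    Tendsto (fun N : ℕ => fourierCos f 0 / 2 + ∑ k ∈ Finset.Ico 1 N, (1 - (k : ℝ) / N) *
      (fourierCos f k * cos (k * x) + fourierSin f k * sin (k * x))) atTop (nhds (f x)) := by
  have h := tendsto_integral_fejer (g := fun y => f (x - y)) (by fun_prop)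
  simp only [sub_zero] at h
  refine h.congr' ?_
  filter_upwards [eventually_ge_atTop 1] with N hN
  have hper : Function.Periodic (fun y => f (x - y) * fejer N y) (2 * π) := by
    intro y
    simp only
    rw [periodic_fejer hN y, show x - (y + 2 * π) = x - y - 2 * π by ring, hf.1.sub_eq]
  have h1 := integral_comp_sub_period hper x
  simp only [sub_sub_cancel] at h1
  rw [← h1]
  have hi := L1per.intervalIntegrable hf
  have h2 := integral_mul_sum_cos_sub hf (Finset.Ico 1 N) (fun k => 1 - (k : ℝ) / N) x 0
  simp only [sub_zero] at h2
  have h3 : ∀ t, f t * fejer N (x - t)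
      = f t + 2 * (f t * ∑ k ∈ Finset.Ico 1 N, (1 - (k : ℝ) / N) * cos (k * (x - t))) := by
    intro t
    rw [fejer_eq hN]; ring
  simp_rw [h3]
  rw [intervalIntegral.integral_add hi ((hi.mul_continuousOn (by fun_prop)).const_mul _),
    intervalIntegral.integral_const_mul, h2]
  have h4 : fourierCos f 0 = (1 / π) * ∫ t in (0 : ℝ)..(2 * π), f t := by simp [fourierCos]
  rw [h4]
  generalize ∑ k ∈ Finset.Ico 1 N, (1 - (k : ℝ) / N) *
      (fourierCos f k * cos (k * x) + fourierSin f k * sin (k * x)) = S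
  field_simp

/-! ### The deviation as a limit of convolutions with finite kernels. -/

/-- Cesàro weights inserted into the finite sum `Z f` disappear in the limit; subtracting it from
the Fejér means of `f` leaves the multiplier `1 - (1 - (k/n)^s)` below `n` and `1` from `n` on, that
is, `damp`. -/
theorem zygmundSum_tendsto {f : ℝ → ℝ} (hf : f ∈ L1per) (hc : Continuous f) {s : ℝ} (hs : 0 < s)
    {n : ℕ} (hn : 1 ≤ n) (x : ℝ) :
    Tendsto (fun N : ℕ => ∑ k ∈ Finset.Ico 1 N, (1 - (k : ℝ) / N) * damp s n k *
      (fourierCos f k * cos (k * x) + fourierSin f k * sin (k * x))) atTop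
      (nhds (f x - zygmundSum s n f x)) := by
  have hZ : Tendsto (fun N : ℕ => fourierCos f 0 / 2 + ∑ k ∈ Finset.Ico 1 n,
      (1 - (k : ℝ) / N) * ((1 - ((k : ℝ) / n) ^ s) *
        (fourierCos f k * cos (k * x) + fourierSin f k * sin (k * x)))) atTop
      (nhds (zygmundSum s n f x)) := by
    rw [zygmundSum]
    refine tendsto_const_nhds.add (tendsto_finsetSum _ fun k _ => ?_)
    have h0 : Tendsto (fun N : ℕ => 1 - (k : ℝ) / N) atTop (nhds (1 - 0)) :=
      tendsto_const_nhds.sub (tendsto_const_div_atTop_nhds_zero_nat _)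
    simpa using h0.mul_const ((1 - ((k : ℝ) / n) ^ s) *
        (fourierCos f k * cos (k * x) + fourierSin f k * sin (k * x)))
  refine ((tendsto_fejer_means hf hc x).sub hZ).congr' ?_
  filter_upwards [eventually_ge_atTop n] with N hN
  rw [add_sub_add_left_eq_sub, sub_eq_iff_eq_add]
  have h1 : ∑ k ∈ Finset.Ico 1 n, (1 - (k : ℝ) / N) * ((1 - ((k : ℝ) / n) ^ s) *
        (fourierCos f k * cos (k * x) + fourierSin f k * sin (k * x)))
      = ∑ k ∈ Finset.Ico 1 N, (1 - (k : ℝ) / N) * ((1 - damp s n k) *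
        (fourierCos f k * cos (k * x) + fourierSin f k * sin (k * x))) := by
    rw [← Finset.sum_Ico_consecutive _ hn hN, Finset.sum_eq_zero (s := Finset.Ico n N), add_zero]
    · refine Finset.sum_congr rfl fun k hk => ?_
      rw [damp_of_ge hs hn (Finset.mem_Ico.1 hk).2.le]
    · intro k hk
      rw [damp_of_le hs hn (Finset.mem_Ico.1 hk).1]; ring
  rw [h1, ← Finset.sum_add_distrib]
  refine Finset.sum_congr rfl fun k _ => ?_
  ring

/-- Coefficients of the regularised kernel of the deviation of Zygmund sums. -/
noncomputable def cesaroCoeff (ψ : ℝ → ℝ) (L k : ℕ) : ℝ := max 0 (1 - (k : ℝ) / L) * ψ k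

/-- Passing from `f` to `φ` divides by `ψ` and rotates the phase by `βπ/2`; the kernel undoes both.
A bound uniform in `L` survives the limit, and the factor `1 / π` is discarded. -/
theorem abs_sub_zygmundSum_le {ψ : ℝ → ℝ} (hψ : ∀ k : ℕ, 1 ≤ k → 0 < ψ k) {β s : ℝ} (hs : 0 < s)
    {f φ : ℝ → ℝ} (hf : f ∈ L1per) (hc : Continuous f) (hφ : IsPsiBetaDeriv ψ β f φ)
    {n : ℕ} (hn : 1 ≤ n) (x : ℝ) {B : ℝ}
    (hB : ∀ L : ℕ, 1 ≤ L → |∫ t in (0 : ℝ)..(2 * π), φ t * ∑ k ∈ Finset.Ico 1 L,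
      damp s n k * cesaroCoeff ψ L k * cos (k * (x - t) - β * π / 2)| ≤ B) :
    |f x - zygmundSum s n f x| ≤ B := by
  refine le_of_tendsto (zygmundSum_tendsto hf hc hs hn x).abs ?_
  filter_upwards [eventually_ge_atTop 1] with L hL
  have h := hB L hL
  rw [integral_mul_sum_cos_sub hφ.1] at h
  have e : ∑ k ∈ Finset.Ico 1 L, damp s n k * cesaroCoeff ψ L k *
        (fourierCos φ k * cos (k * x - β * π / 2) + fourierSin φ k * sin (k * x - β * π / 2))
      = ∑ k ∈ Finset.Ico 1 L, (1 - (k : ℝ) / L) * damp s n k *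
      (fourierCos f k * cos (k * x) + fourierSin f k * sin (k * x)) := by
    refine Finset.sum_congr rfl fun k hk => ?_
    obtain ⟨hk1, hkL⟩ := Finset.mem_Ico.1 hk
    have hk0 : k ≠ 0 := by omega
    obtain ⟨ha, hb⟩ := hφ.2.2 k hk1
    simp only [hk0, if_false] at ha
    have hpos := (hψ k hk1).ne'
    have hm : max 0 (1 - (k : ℝ) / L) = 1 - (k : ℝ) / L := by
      refine max_eq_right ?_
      rw [sub_nonneg, div_le_one (by exact_mod_cast hL)]
      exact_mod_cast hkL.le
    rw [cesaroCoeff, hm, ha, hb, cos_sub, sin_sub]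
    generalize 1 - (k : ℝ) / L = w
    field_simp
    linear_combination damp s n k * w * (fourierCos f k * cos (k * x) + fourierSin f k * sin (k * x)) *
      sin_sq_add_cos_sq (β * π / 2)
  rw [e, abs_mul, abs_of_pos pi_pos] at h
  have h1 : (1 : ℝ) ≤ π := by linarith [pi_gt_three]
  have h0 := abs_nonneg (∑ k ∈ Finset.Ico 1 L, (1 - (k : ℝ) / L) * damp s n k *
      (fourierCos f k * cos (k * x) + fourierSin f k * sin (k * x)))
  nlinarith

theorem cesaroCoeff_nonneg {ψ : ℝ → ℝ} (hψ : ∀ k : ℕ, 1 ≤ k → 0 < ψ k) (L : ℕ) {k : ℕ}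
    (hk : 1 ≤ k) : 0 ≤ cesaroCoeff ψ L k :=
  mul_nonneg (le_max_left _ _) (hψ k hk).le

theorem cesaroCoeff_le {ψ : ℝ → ℝ} (hψ : ∀ k : ℕ, 1 ≤ k → 0 < ψ k) (L : ℕ) {k : ℕ}
    (hk : 1 ≤ k) : cesaroCoeff ψ L k ≤ ψ k := by
  refine mul_le_of_le_one_left (hψ k hk).le (max_le zero_le_one ?_)
  have : (0 : ℝ) ≤ (k : ℝ) / L := by positivity
  linarith

/-- Removes the boundary term in Abel summation. -/
theorem cesaroCoeff_self (ψ : ℝ → ℝ) {L : ℕ} (hL : 1 ≤ L) : cesaroCoeff ψ L L = 0 := by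
  have : (L : ℝ) ≠ 0 := by positivity
  simp [cesaroCoeff, div_self this]

theorem cesaroCoeff_succ_le {ψ : ℝ → ℝ} (hψ : ∀ k : ℕ, 1 ≤ k → 0 < ψ k)
    (hanti : AntitoneOn ψ (Ici 1)) (L : ℕ) {k : ℕ} (hk : 1 ≤ k) :
    cesaroCoeff ψ L (k + 1) ≤ cesaroCoeff ψ L k := by
  have hk1 : (1 : ℝ) ≤ k := by exact_mod_cast hk
  refine mul_le_mul ?_ (hanti hk1 (show (1 : ℝ) ≤ ((k + 1 : ℕ) : ℝ) by push_cast; linarith)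
    (by push_cast; linarith)) (hψ (k + 1) (by omega)).le (le_max_left _ _)
  gcongr
  exact k.le_succ

/-! ### Integral estimates and duality. -/

/-- Splitting at `1 / n`, where the two majorants coincide, makes each piece at most `E / δ`: the
powers of `n` cancel. -/
theorem integral_zero_pi_le {κ : ℝ → ℝ} (hc : Continuous κ) {E δ : ℝ}
    (hδ : 0 < δ) {n : ℕ} (hn : 1 ≤ n)
    (h1 : ∀ u, 0 < u → u ≤ π → κ u ≤ E * (n : ℝ) ^ δ * u ^ (δ - 1))
    (h2 : ∀ u, 0 < u → u ≤ π → κ u ≤ E * (n : ℝ) ^ (-δ) * u ^ (-δ - 1)) (hE : 0 ≤ E) :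
    ∫ u in (0 : ℝ)..π, κ u ≤ 2 * E / δ := by
  have hn1 : (1 : ℝ) ≤ n := by exact_mod_cast hn
  have hn0 : (0 : ℝ) < n := by linarith
  have hm0 : (0 : ℝ) < 1 / n := by positivity
  have hmπ : 1 / (n : ℝ) ≤ π := by
    have : 1 / (n : ℝ) ≤ 1 := by rw [div_le_one hn0]; exact hn1
    linarith [pi_gt_three]
  have h0notin : (0 : ℝ) ∉ uIcc (1 / (n : ℝ)) π := by
    rw [uIcc_of_le hmπ]; intro h; linarith [h.1]
  rw [← intervalIntegral.integral_add_adjacent_intervals (hc.intervalIntegrable 0 (1 / n))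
    (hc.intervalIntegrable (1 / n) π)]
  have A : ∫ u in (0 : ℝ)..(1 / n), κ u ≤ E / δ := by
    have hi : IntervalIntegrable (fun u : ℝ => E * (n : ℝ) ^ δ * u ^ (δ - 1)) volume 0 (1 / n) :=
      (intervalIntegral.intervalIntegrable_rpow' (by linarith)).const_mul _
    refine (intervalIntegral.integral_mono_on_of_le_Ioo hm0.le (hc.intervalIntegrable _ _) hi
      fun u hu => h1 u hu.1 (hu.2.le.trans hmπ)).trans ?_
    rw [intervalIntegral.integral_const_mul, integral_rpow (Or.inl (by linarith)),
      sub_add_cancel, zero_rpow hδ.ne', sub_zero, one_div, inv_rpow hn0.le]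
    have : (n : ℝ) ^ δ ≠ 0 := by positivity
    field_simp
    exact le_rfl
  have B : ∫ u in (1 / (n : ℝ))..π, κ u ≤ E / δ := by
    have hi : IntervalIntegrable (fun u : ℝ => E * (n : ℝ) ^ (-δ) * u ^ (-δ - 1)) volume
        (1 / n) π := (intervalIntegral.intervalIntegrable_rpow (Or.inr h0notin)).const_mul _
    refine (intervalIntegral.integral_mono_on_of_le_Ioo hmπ (hc.intervalIntegrable _ _) hi
      fun u hu => h2 u (hm0.trans hu.1) hu.2.le).trans ?_
    rw [intervalIntegral.integral_const_mul,
      integral_rpow (Or.inr ⟨by linarith, h0notin⟩), sub_add_cancel, one_div, inv_rpow hn0.le,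
      rpow_neg hn0.le, inv_inv]
    have hN : 0 < (n : ℝ) ^ δ := by positivity
    have hP : 0 < π ^ (-δ) := by positivity
    rw [div_neg, ← neg_div, neg_sub, mul_div_assoc', div_le_div_iff_of_pos_right hδ, mul_assoc]
    refine mul_le_of_le_one_right hE ?_
    rw [inv_mul_le_iff₀ hN]
    linarith
  calc _ ≤ E / δ + E / δ := add_le_add A B
    _ = _ := by ring

theorem integral_neg_pi_pi_le {κ : ℝ → ℝ} (hc : Continuous κ) {E δ : ℝ}
    (hδ : 0 < δ) {n : ℕ} (hn : 1 ≤ n)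
    (h1 : ∀ u, u ≠ 0 → |u| ≤ π → κ u ≤ E * (n : ℝ) ^ δ * |u| ^ (δ - 1))
    (h2 : ∀ u, u ≠ 0 → |u| ≤ π → κ u ≤ E * (n : ℝ) ^ (-δ) * |u| ^ (-δ - 1)) (hE : 0 ≤ E) :
    ∫ u in (-π)..π, κ u ≤ 4 * E / δ := by
  rw [← intervalIntegral.integral_add_adjacent_intervals (hc.intervalIntegrable (-π) 0)
    (hc.intervalIntegrable 0 π)]
  have A := integral_zero_pi_le hc hδ hn
    (fun u hu huπ => by simpa [abs_of_pos hu] using h1 u hu.ne' (by rwa [abs_of_pos hu]))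
    (fun u hu huπ => by simpa [abs_of_pos hu] using h2 u hu.ne' (by rwa [abs_of_pos hu])) hE
  have B := integral_zero_pi_le (κ := fun u => κ (-u)) (by fun_prop) hδ hn
    (fun u hu huπ => by
      simpa [abs_of_pos hu] using h1 (-u) (neg_ne_zero.2 hu.ne') (by rwa [abs_neg, abs_of_pos hu]))
    (fun u hu huπ => by
      simpa [abs_of_pos hu] using h2 (-u) (neg_ne_zero.2 hu.ne') (by rwa [abs_neg, abs_of_pos hu]))
    hE
  rw [intervalIntegral.integral_comp_neg, neg_zero] at B
  calc _ ≤ 2 * E / δ + 2 * E / δ := add_le_add B A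
    _ = _ := by ring

theorem unitBall_integral_rpow_le {p : ℝ} (hp : 1 ≤ p) {φ : ℝ → ℝ} (hφ : φ ∈ unitBall p) :
    ∫ t in (0 : ℝ)..(2 * π), |φ t| ^ p ≤ 1 := by
  obtain ⟨-, hm, hle⟩ := hφ
  have hp0 : 0 < p := by linarith
  rw [hm.eLpNorm_eq_integral_rpow_norm (by simpa using hp0) ENNReal.ofReal_ne_top,
    ENNReal.ofReal_le_one, ENNReal.toReal_ofReal hp0.le] at hle
  rw [intervalIntegral.integral_of_le (by positivity)]
  have h0 : 0 ≤ ∫ t in Ioc 0 (2 * π), ‖φ t‖ ^ p := integral_nonneg fun t => by positivity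
  by_contra! h
  have h' : 1 < ∫ t in Ioc 0 (2 * π), ‖φ t‖ ^ p := h
  exact absurd hle (not_le.2 (one_lt_rpow h' (by positivity)))

theorem abs_integral_mul_le_of_bounded {φ κ : ℝ → ℝ} (hφ : φ ∈ unitBall 1) (hφ1 : φ ∈ L1per)
    (hκ : Continuous κ) {M : ℝ} (hM : ∀ u, |κ u| ≤ M) :
    |∫ t in (0 : ℝ)..(2 * π), φ t * κ t| ≤ M := by
  have hi := L1per.intervalIntegrable hφ1
  have hπ : (0 : ℝ) ≤ 2 * π := by positivity
  have h1 := unitBall_integral_rpow_le le_rfl hφ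
  simp only [rpow_one] at h1
  have hM0 : 0 ≤ M := (abs_nonneg _).trans (hM 0)
  calc _ ≤ ∫ t in (0 : ℝ)..(2 * π), |φ t * κ t| := intervalIntegral.abs_integral_le_integral_abs hπ
    _ ≤ ∫ t in (0 : ℝ)..(2 * π), |φ t| * M := by
        refine intervalIntegral.integral_mono_on hπ (hi.mul_continuousOn hκ.continuousOn).abs
          (hi.abs.mul_const _) fun t _ => ?_
        rw [abs_mul]
        exact mul_le_mul_of_nonneg_left (hM t) (abs_nonneg _)
    _ = (∫ t in (0 : ℝ)..(2 * π), |φ t|) * M := intervalIntegral.integral_mul_const _ _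
    _ ≤ 1 * M := by gcongr
    _ = M := one_mul M

theorem abs_integral_mul_le_of_Lq {p q : ℝ} (hpq : p.HolderConjugate q) {φ κ : ℝ → ℝ}
    (hφ : φ ∈ unitBall p) (hκ : Continuous κ) :
    |∫ t in (0 : ℝ)..(2 * π), φ t * κ t|
      ≤ (∫ t in (0 : ℝ)..(2 * π), |κ t| ^ q) ^ (1 / q) := by
  have hπ : (0 : ℝ) ≤ 2 * π := by positivity
  have h1 := unitBall_integral_rpow_le hpq.lt.le hφ
  have hκm : MemLp κ (ENNReal.ofReal q) (volume.restrict (Ioc 0 (2 * π))) := by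
    obtain ⟨C, hC⟩ := (isCompact_Icc (a := (0 : ℝ)) (b := 2 * π)).exists_bound_of_continuousOn
      hκ.continuousOn
    refine MemLp.of_bound hκ.aestronglyMeasurable C ?_
    filter_upwards [self_mem_ae_restrict measurableSet_Ioc] with t ht
    exact hC t (Ioc_subset_Icc_self ht)
  have h := integral_mul_norm_le_Lp_mul_Lq hpq hφ.2.1 hκm
  simp only [intervalIntegral.integral_of_le hπ] at h1 ⊢
  have h0 : 0 ≤ ∫ t in Ioc 0 (2 * π), |φ t| ^ p := integral_nonneg fun t => by positivity
  have h2 : 0 ≤ ∫ t in Ioc 0 (2 * π), |κ t| ^ q := integral_nonneg fun t => by positivity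
  calc _ ≤ ∫ t in Ioc 0 (2 * π), ‖φ t * κ t‖ := norm_integral_le_integral_norm _
    _ = ∫ t in Ioc 0 (2 * π), ‖φ t‖ * ‖κ t‖ := by simp_rw [norm_mul]
    _ ≤ _ := h
    _ ≤ 1 * (∫ t in Ioc 0 (2 * π), |κ t| ^ q) ^ (1 / q) := by
        refine mul_le_mul_of_nonneg_right ?_ (by positivity)
        exact rpow_le_one h0 h1 (by have := hpq.pos; positivity)
    _ = _ := one_mul _

/-! ### Upper bounds for the Zygmund deviation. -/

theorem bigO_zygmundDev_of_forall {ψ : ℝ → ℝ} {β p s δ C : ℝ}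
    (h : ∀ n : ℕ, 1 ≤ n → ∀ f ∈ classC ψ β p, ∀ x,
      |f x - zygmundSum s n f x| ≤ C * (ψ n * (n : ℝ) ^ δ))
    (hψ : ∀ k : ℕ, 1 ≤ k → 0 < ψ k) :
    BigO (fun n => zygmundDev (classC ψ β p) s n)
      (fun n => ENNReal.ofReal (ψ n * (n : ℝ) ^ δ)) := by
  refine ⟨Real.toNNReal (max C 1), by simp, fun n hn => ?_⟩
  have h0 : 0 ≤ ψ n * (n : ℝ) ^ δ := mul_nonneg (hψ n hn).le (by positivity)
  refine iSup₂_le fun f hf => iSup_le fun x => ?_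
  change ENNReal.ofReal _ ≤ ENNReal.ofReal (max C 1) * _
  rw [← ENNReal.ofReal_mul (by positivity)]
  refine ENNReal.ofReal_le_ofReal ((h n hn f hf x).trans ?_)
  gcongr
  exact le_max_left _ _

theorem bigO_zygmundDev_one {ψ : ℝ → ℝ} {s β : ℝ} (hs : 0 < s)
    (hMC : gfun ψ 1 ∈ MC) (hGA : (fun k : ℕ => gfun ψ (s + 1) k) ∈ GAplus) :
    BigO (fun n => zygmundDev (classC ψ β 1) s n)
      (fun n => ENNReal.ofReal (ψ n * (n : ℝ) ^ (1 : ℝ))) := by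
  obtain ⟨γ₀, hγ₀, C, hC, hb⟩ := damp_mul_psi_le hs hMC hGA
  have hψ : ∀ k : ℕ, 1 ≤ k → 0 < ψ k := fun k hk => psi_pos hMC.1 (by exact_mod_cast hk)
  set γ : ℝ := min γ₀ 1 with hγ
  have hγ0 : 0 < γ := by positivity
  have hγ1 : γ ≤ 1 := min_le_right _ _
  refine bigO_zygmundDev_of_forall (C := 2 * C / γ) ?_ hψ
  rintro n hn f ⟨⟨hf, φ, hφU, hφ⟩, hc⟩ x
  have hn0 : (0 : ℝ) < n := by exact_mod_cast hn
  have hG : 0 < ψ n * (n : ℝ) ^ (1 : ℝ) := mul_pos (hψ n hn) (by positivity)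
  refine abs_sub_zygmundSum_le hψ hs hf hc hφ hn x fun L hL => ?_
  refine abs_integral_mul_le_of_bounded hφU hφ.1 (by fun_prop) fun t => ?_
  set G := ψ n * (n : ℝ) ^ (1 : ℝ) with hGdef
  have hterm : ∀ k, 1 ≤ k → 0 ≤ damp s n k * ψ k := fun k hk =>
    mul_nonneg (damp_nonneg _ _ _) (hψ k hk).le
  calc _ ≤ ∑ k ∈ Finset.Ico 1 L, damp s n k * ψ k := by
        refine (Finset.abs_sum_le_sum_abs _ _).trans (Finset.sum_le_sum fun k hk => ?_)
        have hk1 := (Finset.mem_Ico.1 hk).1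
        have h0 := mul_nonneg (damp_nonneg s n k) (cesaroCoeff_nonneg hψ L hk1)
        rw [abs_mul, abs_of_nonneg h0]
        refine (mul_le_of_le_one_right h0 (abs_cos_le_one _)).trans ?_
        exact mul_le_mul_of_nonneg_left (cesaroCoeff_le hψ L hk1) (damp_nonneg _ _ _)
    _ ≤ ∑ k ∈ Finset.Ico 1 (n + 1 + L), damp s n k * ψ k :=
        Finset.sum_le_sum_of_subset_of_nonneg (Finset.Ico_subset_Ico le_rfl (by omega))
          fun k hk _ => hterm k (Finset.mem_Ico.1 hk).1
    _ = ∑ k ∈ Finset.Ico 1 (n + 1), damp s n k * ψ k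
        + ∑ k ∈ Finset.Ico n (n + L), damp s n (k + 1) * ψ ((k + 1 : ℕ) : ℝ) := by
        rw [Finset.sum_Ico_add' (fun k => damp s n k * ψ k) n (n + L) 1,
          show n + L + 1 = n + 1 + L by ring,
          Finset.sum_Ico_consecutive _ (by omega) (by omega)]
    -- The exponent `σ = γ` makes the low part grow like `n ^ γ`; `σ = -γ` makes the tail summable.
    _ ≤ ∑ k ∈ Finset.Ico 1 (n + 1), C * G * (n : ℝ) ^ (-γ) * (k : ℝ) ^ (γ - 1)
        + ∑ k ∈ Finset.Ico n (n + L), C * G * (n : ℝ) ^ γ * ((k + 1 : ℕ) : ℝ) ^ (-γ - 1) := by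
        refine add_le_add (Finset.sum_le_sum fun k hk => ?_) (Finset.sum_le_sum fun k hk => ?_)
        · have := hb γ (by rw [abs_of_pos hγ0]; exact min_le_left _ _) n k hn
            (Finset.mem_Ico.1 hk).1
          rwa [neg_sub] at this
        · have := hb (-γ) (by rw [abs_neg, abs_of_pos hγ0]; exact min_le_left _ _) n (k + 1) hn
            (by omega)
          rwa [neg_neg, show -(1 - -γ) = -γ - 1 by ring] at this
    _ ≤ C * G * (n : ℝ) ^ (-γ) * ((n : ℝ) ^ γ / γ) + C * G * (n : ℝ) ^ γ * ((n : ℝ) ^ (-γ) / γ) := by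
        rw [← Finset.mul_sum, ← Finset.mul_sum]
        gcongr
        · exact sum_rpow_sub_one_le hγ0 hγ1 n
        · exact sum_rpow_neg_sub_one_le hγ0 hn (by omega)
    _ = 2 * C / γ * G := by
        rw [rpow_neg hn0.le]
        have : (n : ℝ) ^ γ ≠ 0 := by positivity
        field_simp
        ring

theorem bigO_zygmundDev_of_one_lt {ψ : ℝ → ℝ} {s p q β : ℝ} (hs : 0 < s)
    (hpq : p.HolderConjugate q) (hMC : gfun ψ (1 / p) ∈ MC)
    (hGA : (fun k : ℕ => gfun ψ (s + 1 / p) k) ∈ GAplus) :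
    BigO (fun n => zygmundDev (classC ψ β p) s n)
      (fun n => ENNReal.ofReal (ψ n * (n : ℝ) ^ (1 / p))) := by
  obtain ⟨γ₀, hγ₀, C, hC, hb⟩ := damp_mul_psi_le hs hMC hGA
  have hψ : ∀ k : ℕ, 1 ≤ k → 0 < ψ k := fun k hk => psi_pos hMC.1 (by exact_mod_cast hk)
  have hp0 := hpq.pos
  have hq0 := hpq.symm.pos
  have hsum : 1 / p + 1 / q = 1 := by simpa using hpq.inv_add_inv_eq_one
  have hip : 0 < 1 / p := by positivity
  have hiq : 0 < 1 / q := by positivity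
  have hanti := psi_antitoneOn hip.le hMC.1
  -- These bounds keep both exponents `1 / p ± γ` strictly inside `(0, 1)`, as Abel summation
  -- requires.
  obtain ⟨γ, hγ0, hγγ, hγp, hγq⟩ : ∃ γ : ℝ, 0 < γ ∧ γ ≤ γ₀ ∧ γ < 1 / p ∧ γ < 1 / q := by
    refine ⟨min γ₀ (min (1 / p) (1 / q) / 2), by positivity, min_le_left _ _, ?_, ?_⟩
    · have h1 := min_le_right γ₀ (min (1 / p) (1 / q) / 2)
      have h2 := min_le_left (1 / p) (1 / q)
      linarith
    · have h1 := min_le_right γ₀ (min (1 / p) (1 / q) / 2)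
      have h2 := min_le_right (1 / p) (1 / q)
      linarith
  have hM : ∃ M : ℝ, 0 < M ∧ ∀ σ : ℝ, |σ| = γ →
      5 / (1 - (1 / p - σ)) + π * (1 + 2 * max s 1 / (1 / p - σ)) ≤ M := by
    have h1 := abs_of_pos hγ0
    refine ⟨max (5 / (1 - (1 / p - γ)) + π * (1 + 2 * max s 1 / (1 / p - γ)))
      (5 / (1 - (1 / p - -γ)) + π * (1 + 2 * max s 1 / (1 / p - -γ))), ?_, fun σ hσ => ?_⟩
    · refine lt_max_of_lt_left ?_
      have a1 : 0 < 1 - (1 / p - γ) := by linarith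
      have a2 : 0 < 1 / p - γ := by linarith
      positivity
    · rcases eq_or_eq_neg_of_abs_eq hσ with rfl | rfl
      · exact le_max_left _ _
      · exact le_max_right _ _
  obtain ⟨M, hM0, hM⟩ := hM
  refine bigO_zygmundDev_of_forall (C := M * C * (4 / (γ * q)) ^ (1 / q)) ?_ hψ
  rintro n hn f ⟨⟨hf, φ, hφU, hφ⟩, hc⟩ x
  have hn0 : (0 : ℝ) < n := by exact_mod_cast hn
  have hG : 0 < ψ n * (n : ℝ) ^ (1 / p) := mul_pos (hψ n hn) (by positivity)
  set G := ψ n * (n : ℝ) ^ (1 / p) with hGdef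
  refine abs_sub_zygmundSum_le hψ hs hf hc hφ hn x fun L hL => ?_
  refine (abs_integral_mul_le_of_Lq hpq hφU (by fun_prop)).trans ?_
  set κ : ℝ → ℝ := fun u => ∑ k ∈ Finset.Ico 1 L,
    damp s n k * cesaroCoeff ψ L k * cos (k * u - β * π / 2) with hκ
  have hκc : Continuous κ := by rw [hκ]; fun_prop
  have hκper : Function.Periodic (fun u => |κ u| ^ q) (2 * π) := by
    intro u
    have := periodic_sum_cos (Finset.Ico 1 L) (fun k => damp s n k * cesaroCoeff ψ L k)
      (β * π / 2) u
    simp only [hκ] at this ⊢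
    rw [this]
  have hpt : ∀ σ : ℝ, |σ| = γ → ∀ u, u ≠ 0 → |u| ≤ π →
      |κ u| ^ q ≤ (M * C * G) ^ q * (n : ℝ) ^ (-(σ * q)) * |u| ^ (-(σ * q) - 1) := by
    intro σ hσ u hu huπ
    have hu0 : 0 < |u| := abs_pos.2 hu
    have hσ1 := neg_le_of_abs_le hσ.le
    have hσ2 := le_of_abs_le hσ.le
    have h := abs_sum_damp_mul_cos_le (s := s) (a := 1 / p - σ) (D := C * G * (n : ℝ) ^ (-σ)) hs
      (by linarith) (by linarith) hn (fun k hk => cesaroCoeff_nonneg hψ L hk)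
      (fun k hk => cesaroCoeff_succ_le hψ hanti L hk) (cesaroCoeff_self ψ hL)
      (fun k hk => (mul_le_mul_of_nonneg_left (cesaroCoeff_le hψ L hk)
        (damp_nonneg _ _ _)).trans (hb σ (hσ.le.trans hγγ) n k hn hk)) hu huπ (β * π / 2)
    have h' : |κ u| ≤ M * C * G * (n : ℝ) ^ (-σ) * |u| ^ (1 / p - σ - 1) := by
      refine h.trans ?_
      calc _ ≤ M * (C * G * (n : ℝ) ^ (-σ)) * |u| ^ (1 / p - σ - 1) := by
            gcongr; exact hM σ hσ
        _ = _ := by ring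
    calc |κ u| ^ q ≤ (M * C * G * (n : ℝ) ^ (-σ) * |u| ^ (1 / p - σ - 1)) ^ q :=
          rpow_le_rpow (abs_nonneg _) h' hq0.le
      _ = (M * C * G) ^ q * (n : ℝ) ^ (-σ * q) * |u| ^ ((1 / p - σ - 1) * q) := by
          rw [mul_rpow (by positivity) (by positivity), mul_rpow (by positivity) (by positivity),
            ← rpow_mul hn0.le, ← rpow_mul hu0.le]
      _ = _ := by
          -- At `σ = 0` the exponent would be the critical `-1`; the two signs of `σ` give
          -- integrability at `0` and at the scale `1 / n`.
          have e : (1 / p - σ - 1) * q = -(σ * q) - 1 := by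
            have : 1 / p = 1 - 1 / q := by linarith
            rw [this]; field_simp; ring
          rw [e, neg_mul]
  have hint : ∫ u in (-π)..π, |κ u| ^ q ≤ 4 * (M * C * G) ^ q / (γ * q) := by
    refine integral_neg_pi_pi_le (hκc.abs.rpow_const fun _ => Or.inr hq0.le) (by positivity) hn
      (fun u hu huπ => ?_) (fun u hu huπ => ?_) (by positivity)
    · simpa using hpt (-γ) (by rw [abs_neg, abs_of_pos hγ0]) u hu huπ
    · simpa using hpt γ (abs_of_pos hγ0) u hu huπ
  rw [integral_comp_sub_period hκper x]
  calc _ ≤ (4 * (M * C * G) ^ q / (γ * q)) ^ (1 / q) := by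
        refine rpow_le_rpow ?_ hint (by positivity)
        exact intervalIntegral.integral_nonneg (by linarith [pi_pos]) fun u _ => by positivity
    _ = ((M * C * G) ^ q * (4 / (γ * q))) ^ (1 / q) := by ring_nf
    _ = M * C * G * (4 / (γ * q)) ^ (1 / q) := by
        rw [mul_rpow (by positivity) (by positivity), ← rpow_mul (by positivity),
          mul_one_div_cancel hq0.ne', rpow_one]
    _ = _ := by ring

/-! ### Fourier coefficients of finite cosine sums. -/

theorem integral_cos_mul_cos_of_ne {m k : ℕ} (h : m ≠ k) (θ η : ℝ) :
    ∫ x in (0 : ℝ)..(2 * π), cos (m * x + θ) * cos (k * x + η) = 0 := by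
  have e : ∀ x : ℝ, cos (m * x + θ) * cos (k * x + η)
      = 1 / 2 * cos (((m + k : ℤ) : ℝ) * x + (θ + η))
        + 1 / 2 * cos (((m - k : ℤ) : ℝ) * x + (θ - η)) := by
    intro x
    push_cast
    rw [show ((m : ℝ) + k) * x + (θ + η) = (m * x + θ) + (k * x + η) by ring,
      show ((m : ℝ) - k) * x + (θ - η) = (m * x + θ) - (k * x + η) by ring, cos_add (m * x + θ) (k * x + η),
      cos_sub (m * x + θ) (k * x + η)]
    ring
  simp_rw [e]
  rw [intervalIntegral.integral_add (Continuous.intervalIntegrable (by fun_prop) _ _)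
    (Continuous.intervalIntegrable (by fun_prop) _ _), intervalIntegral.integral_const_mul,
    intervalIntegral.integral_const_mul]
  have h1 := integral_cos_period (z := m + k) (by omega) 0 (θ + η)
  have h2 := integral_cos_period (z := m - k) (by omega) 0 (θ - η)
  rw [zero_add] at h1 h2
  rw [h1, h2]; simp

theorem integral_cos_mul_cos_self {m : ℕ} (h : 1 ≤ m) (θ η : ℝ) :
    ∫ x in (0 : ℝ)..(2 * π), cos (m * x + θ) * cos (m * x + η) = π * cos (θ - η) := by
  have e : ∀ x : ℝ, cos (m * x + θ) * cos (m * x + η)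
      = 1 / 2 * cos (((2 * m : ℤ) : ℝ) * x + (θ + η)) + 1 / 2 * cos (θ - η) := by
    intro x
    push_cast
    rw [show (2 * (m : ℝ)) * x + (θ + η) = (m * x + θ) + (m * x + η) by ring,
      show θ - η = (m * x + θ) - (m * x + η) by ring, cos_add (m * x + θ) (m * x + η),
      cos_sub (m * x + θ) (m * x + η)]
    ring
  simp_rw [e]
  rw [intervalIntegral.integral_add (Continuous.intervalIntegrable (by fun_prop) _ _)
    (Continuous.intervalIntegrable (by fun_prop) _ _), intervalIntegral.integral_const_mul]
  have h1 := integral_cos_period (z := 2 * m) (by omega) 0 (θ + η)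
  rw [zero_add] at h1
  rw [h1]; simp; ring

theorem fourierCos_cos {m : ℕ} (hm : 1 ≤ m) (θ : ℝ) (k : ℕ) :
    fourierCos (fun x => cos (m * x + θ)) k = if m = k then cos θ else 0 := by
  rw [fourierCos]
  split_ifs with h
  · subst h
    have := integral_cos_mul_cos_self hm θ 0
    simp only [add_zero, sub_zero] at this
    rw [this]; field_simp
  · have := integral_cos_mul_cos_of_ne h θ 0
    simp only [add_zero] at this
    rw [this, mul_zero]

theorem fourierSin_cos {m : ℕ} (hm : 1 ≤ m) (θ : ℝ) (k : ℕ) :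
    fourierSin (fun x => cos (m * x + θ)) k = if m = k then -sin θ else 0 := by
  rw [fourierSin]
  have e : ∀ x : ℝ, sin (k * x) = cos (k * x + -(π / 2)) := fun x => by
    rw [← sub_eq_add_neg, cos_sub_pi_div_two]
  simp_rw [e]
  split_ifs with h
  · subst h
    rw [integral_cos_mul_cos_self hm, sub_neg_eq_add, cos_add_pi_div_two]; field_simp
  · rw [integral_cos_mul_cos_of_ne h, mul_zero]

theorem fourierCos_sum {ι : Type*} (s : Finset ι) (c : ι → ℝ) {h : ι → ℝ → ℝ}
    (hh : ∀ i, Continuous (h i)) (k : ℕ) :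
    fourierCos (fun x => ∑ i ∈ s, c i * h i x) k = ∑ i ∈ s, c i * fourierCos (h i) k := by
  simp only [fourierCos, Finset.sum_mul]
  rw [intervalIntegral.integral_finsetSum fun i _ =>
    Continuous.intervalIntegrable (by have := hh i; fun_prop) _ _, Finset.mul_sum]
  refine Finset.sum_congr rfl fun i _ => ?_
  simp_rw [mul_assoc]
  rw [intervalIntegral.integral_const_mul]; ring

theorem fourierSin_sum {ι : Type*} (s : Finset ι) (c : ι → ℝ) {h : ι → ℝ → ℝ}
    (hh : ∀ i, Continuous (h i)) (k : ℕ) :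
    fourierSin (fun x => ∑ i ∈ s, c i * h i x) k = ∑ i ∈ s, c i * fourierSin (h i) k := by
  simp only [fourierSin, Finset.sum_mul]
  rw [intervalIntegral.integral_finsetSum fun i _ =>
    Continuous.intervalIntegrable (by have := hh i; fun_prop) _ _, Finset.mul_sum]
  refine Finset.sum_congr rfl fun i _ => ?_
  simp_rw [mul_assoc]
  rw [intervalIntegral.integral_const_mul]; ring

/-- Finite sums of shifted cosines. -/
noncomputable def cosSum (s : Finset (ℕ × ℕ)) (c : ℕ × ℕ → ℝ) (m : ℕ × ℕ → ℕ) (θ x : ℝ) : ℝ :=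
  ∑ i ∈ s, c i * cos (m i * x + θ)

theorem continuous_cosSum (s : Finset (ℕ × ℕ)) (c : ℕ × ℕ → ℝ) (m : ℕ × ℕ → ℕ) (θ : ℝ) :
    Continuous (cosSum s c m θ) := by unfold cosSum; fun_prop

theorem periodic_cosSum (s : Finset (ℕ × ℕ)) (c : ℕ × ℕ → ℝ) (m : ℕ × ℕ → ℕ) (θ : ℝ) :
    Function.Periodic (cosSum s c m θ) (2 * π) := by
  intro u
  refine Finset.sum_congr rfl fun k _ => ?_
  rw [show (m k : ℝ) * (u + 2 * π) + θ = (m k * u + θ) + m k * (2 * π) by ring,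
    cos_add_nat_mul_two_pi]

theorem cosSum_mem_L1per (s : Finset (ℕ × ℕ)) (c : ℕ × ℕ → ℝ) (m : ℕ × ℕ → ℕ) (θ : ℝ) :
    cosSum s c m θ ∈ L1per :=
  ⟨periodic_cosSum s c m θ, (continuous_cosSum s c m θ).integrableOn_Ioc⟩

theorem fourierCos_cosSum {s : Finset (ℕ × ℕ)} (c : ℕ × ℕ → ℝ) {m : ℕ × ℕ → ℕ}
    (hm : ∀ i ∈ s, 1 ≤ m i) (θ : ℝ) (k : ℕ) :
    fourierCos (cosSum s c m θ) k = ∑ i ∈ s, c i * if m i = k then cos θ else 0 := by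
  unfold cosSum
  rw [fourierCos_sum s c (h := fun i x => cos (m i * x + θ)) fun i => by fun_prop]
  exact Finset.sum_congr rfl fun i hi => by rw [fourierCos_cos (hm i hi)]

theorem fourierSin_cosSum {s : Finset (ℕ × ℕ)} (c : ℕ × ℕ → ℝ) {m : ℕ × ℕ → ℕ}
    (hm : ∀ i ∈ s, 1 ≤ m i) (θ : ℝ) (k : ℕ) :
    fourierSin (cosSum s c m θ) k = ∑ i ∈ s, c i * if m i = k then -sin θ else 0 := by
  unfold cosSum
  rw [fourierSin_sum s c (h := fun i x => cos (m i * x + θ)) fun i => by fun_prop]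
  exact Finset.sum_congr rfl fun i hi => by rw [fourierSin_cos (hm i hi)]

theorem isPsiBetaDeriv_cosSum {ψ : ℝ → ℝ} {β : ℝ} {s : Finset (ℕ × ℕ)} (c : ℕ × ℕ → ℝ)
    {m : ℕ × ℕ → ℕ} (hm : ∀ i ∈ s, 1 ≤ m i) (hψ : ∀ k : ℕ, 1 ≤ k → 0 < ψ k) :
    IsPsiBetaDeriv ψ β (cosSum s (fun i => c i * ψ (m i)) m 0) (cosSum s c m (β * π / 2)) := by
  refine ⟨cosSum_mem_L1per _ _ _ _, ?_, fun k hk => ?_⟩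
  · rw [fourierCos_cosSum c hm]
    simp only [if_true]
    refine Finset.sum_eq_zero fun i hi => ?_
    have := hm i hi
    rw [if_neg (by omega), mul_zero]
  · have hk0 : k ≠ 0 := by omega
    have hp := (hψ k hk).ne'
    simp only [hk0, if_false]
    rw [fourierCos_cosSum c hm, fourierSin_cosSum c hm, fourierCos_cosSum _ hm,
      fourierSin_cosSum _ hm]
    simp only [cos_zero, sin_zero, neg_zero, ite_self, mul_zero, Finset.sum_const_zero, zero_mul,
      add_zero, zero_sub]
    constructor
    · rw [Finset.sum_mul, Finset.mul_sum]
      refine Finset.sum_congr rfl fun i _ => ?_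
      split_ifs with h
      · rw [h]; field_simp
      · simp
    · rw [Finset.sum_mul, ← Finset.sum_neg_distrib, Finset.mul_sum]
      refine Finset.sum_congr rfl fun i _ => ?_
      split_ifs with h
      · rw [h]; field_simp
      · simp

/-! ### The extremal function and the lower bound. -/

/-- Expanding `|∑ e^(ijx)|²` as a double sum gives frequencies `i - j`, and the terms odd in `(i,
j)` cancel. Since `j < n`, the natural subtraction in `2 * n + i - j` never truncates. -/
theorem cosSum_shifted_eq_fejer {n : ℕ} (hn : 1 ≤ n) (κ θ x : ℝ) :
    cosSum (Finset.range n ×ˢ Finset.range n) (fun _ => κ / n) (fun i => 2 * n + i.1 - i.2) θ x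
      = κ * cos (((2 * n : ℕ) : ℝ) * x + θ) * fejer n x := by
  have hn0 : (n : ℝ) ≠ 0 := by positivity
  set A := ((2 * n : ℕ) : ℝ) * x + θ with hA
  have e : ∀ i ∈ Finset.range n, ∀ j ∈ Finset.range n,
      cos (((2 * n + i - j : ℕ) : ℝ) * x + θ)
      = cos A * (cos (i * x) * cos (j * x)) + cos A * (sin (i * x) * sin (j * x))
        - (sin A * (sin (i * x) * cos (j * x)) - sin A * (cos (i * x) * sin (j * x))) := by
    intro i _ j hj
    have hj' := Finset.mem_range.1 hj
    rw [Nat.cast_sub (by omega), Nat.cast_add,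
      show (((2 * n : ℕ) : ℝ) + i - j) * x + θ = A + (i * x - j * x) by rw [hA]; ring,
      cos_add, cos_sub, sin_sub]
    ring
  rw [cosSum, ← Finset.mul_sum, Finset.sum_product,
    Finset.sum_congr rfl fun i hi => Finset.sum_congr rfl fun j hj => e i hi j hj]
  simp only [Finset.sum_sub_distrib, Finset.sum_add_distrib, ← Finset.mul_sum,
    ← Finset.sum_mul]
  rw [fejer]
  generalize ∑ i ∈ Finset.range n, cos (i * x) = C
  generalize ∑ i ∈ Finset.range n, sin (i * x) = S
  field_simp
  ring

/-- Since `0 ≤ fejer n ≤ 2 n` and its integral is `2π`, the `p`-th power of the kernel integrates to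
at most `(2 n)^(p-1) * 2π`. -/
theorem cosSum_shifted_mem_unitBall {n : ℕ} (hn : 1 ≤ n) {p : ℝ} (hp : 1 ≤ p) {κ : ℝ} (hκ : 0 ≤ κ)
    (hκp : κ ^ p * ((2 * n) ^ (p - 1) * (2 * π)) ≤ 1) (θ : ℝ) :
    cosSum (Finset.range n ×ˢ Finset.range n) (fun _ => κ / n) (fun i => 2 * n + i.1 - i.2) θ
      ∈ unitBall p := by
  set φ := cosSum (Finset.range n ×ˢ Finset.range n) (fun _ => κ / n)
    (fun i => 2 * n + i.1 - i.2) θ with hφ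
  have hp0 : 0 < p := by linarith
  have hπ : (0 : ℝ) ≤ 2 * π := by positivity
  have hc : Continuous φ := continuous_cosSum _ _ _ _
  have hm : MemLp φ (ENNReal.ofReal p) (volume.restrict (Ioc 0 (2 * π))) := by
    obtain ⟨C, hC⟩ := (isCompact_Icc (a := (0 : ℝ)) (b := 2 * π)).exists_bound_of_continuousOn
      hc.continuousOn
    refine MemLp.of_bound hc.aestronglyMeasurable C ?_
    filter_upwards [self_mem_ae_restrict measurableSet_Ioc] with t ht
    exact hC t (Ioc_subset_Icc_self ht)
  refine ⟨periodic_cosSum _ _ _ _, hm, ?_⟩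
  rw [hm.eLpNorm_eq_integral_rpow_norm (by simpa using hp0) ENNReal.ofReal_ne_top,
    ENNReal.ofReal_le_one, ENNReal.toReal_ofReal hp0.le]
  refine rpow_le_one (integral_nonneg fun t => by positivity) ?_ (by positivity)
  rw [← intervalIntegral.integral_of_le hπ]
  refine le_trans ?_ hκp
  have h1 := integral_fejer hn 0
  rw [zero_add] at h1
  have h3 : κ ^ p * ((2 * n) ^ (p - 1) * (2 * π))
      = ∫ x in (0 : ℝ)..(2 * π), κ ^ p * (2 * n) ^ (p - 1) * fejer n x := by
    rw [intervalIntegral.integral_const_mul, h1, mul_assoc]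
  rw [h3]
  refine intervalIntegral.integral_mono_on hπ
    ((hc.norm.rpow_const fun _ => Or.inr hp0.le).intervalIntegrable _ _)
    (((continuous_fejer n).intervalIntegrable (μ := volume) _ _).const_mul _) fun x _ => ?_
  have hF := fejer_nonneg n x
  have h2 : ‖φ x‖ ≤ κ * fejer n x := by
    rw [hφ, cosSum_shifted_eq_fejer hn, Real.norm_eq_abs, abs_mul, abs_mul, abs_of_nonneg hκ,
      abs_of_nonneg hF]
    gcongr
    exact mul_le_of_le_one_right hκ (abs_cos_le_one _)
  calc ‖φ x‖ ^ p ≤ (κ * fejer n x) ^ p := by gcongr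
    _ = κ ^ p * (fejer n x ^ (p - 1) * fejer n x) := by
        rw [mul_rpow hκ hF]
        congr 1
        rcases hF.eq_or_lt with h0 | h0
        · rw [← h0, zero_rpow hp0.ne', mul_zero]
        · rw [rpow_sub_one h0.ne', div_mul_cancel₀ _ h0.ne']
    _ ≤ κ ^ p * ((2 * n) ^ (p - 1) * fejer n x) := by
        gcongr
        exact fejer_le_two_mul n x
    _ = _ := by ring

theorem fourierCos_trigPoly {n : ℕ} {t : ℝ → ℝ} (ht : t ∈ trigPoly n) {m : ℕ} (hm : n ≤ m)
    (hm1 : 1 ≤ m) : fourierCos t m = 0 := by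
  obtain ⟨c, d, h⟩ := ht
  have e : ∀ x, t x * cos (m * x) = c 0 / 2 * cos (m * x)
      + ∑ k ∈ Finset.Ico 1 n, (c k * (cos (k * x + 0) * cos (m * x + 0))
        + d k * (cos (k * x + -(π / 2)) * cos (m * x + 0))) := by
    intro x
    rw [h, add_mul, Finset.sum_mul]
    congr 1
    refine Finset.sum_congr rfl fun k _ => ?_
    rw [← sub_eq_add_neg, cos_sub_pi_div_two]; simp only [add_zero]; ring
  have h1 := integral_cos_nat_period hm1 0
  rw [zero_add] at h1
  rw [fourierCos]
  simp_rw [e]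
  rw [intervalIntegral.integral_add (Continuous.intervalIntegrable (by fun_prop) _ _)
    (Continuous.intervalIntegrable (by fun_prop) _ _), intervalIntegral.integral_const_mul, h1,
    intervalIntegral.integral_finsetSum
      fun k _ => Continuous.intervalIntegrable (by fun_prop) _ _,
    Finset.sum_eq_zero, mul_zero, add_zero, mul_zero]
  intro k hk
  have hkm : k ≠ m := by have := (Finset.mem_Ico.1 hk).2; omega
  rw [intervalIntegral.integral_add (Continuous.intervalIntegrable (by fun_prop) _ _)
    (Continuous.intervalIntegrable (by fun_prop) _ _), intervalIntegral.integral_const_mul,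
    intervalIntegral.integral_const_mul, integral_cos_mul_cos_of_ne hkm,
    integral_cos_mul_cos_of_ne hkm]
  simp

theorem continuous_of_mem_trigPoly {n : ℕ} {t : ℝ → ℝ} (ht : t ∈ trigPoly n) : Continuous t := by
  obtain ⟨c, d, h⟩ := ht
  rw [funext h]; fun_prop

theorem integral_mul_cosSum {h : ℝ → ℝ} (hh : Continuous h) (s : Finset (ℕ × ℕ)) (c : ℕ × ℕ → ℝ)
    (m : ℕ × ℕ → ℕ) :
    ∫ x in (0 : ℝ)..(2 * π), h x * cosSum s c m 0 x = π * ∑ i ∈ s, c i * fourierCos h (m i) := by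
  simp only [cosSum, add_zero, Finset.mul_sum, fourierCos]
  rw [intervalIntegral.integral_finsetSum fun k _ => Continuous.intervalIntegrable (by fun_prop) _ _]
  refine Finset.sum_congr rfl fun i _ => ?_
  simp_rw [mul_left_comm (h _)]
  rw [intervalIntegral.integral_const_mul]
  field_simp

/-- Cauchy–Schwarz for the fibre sizes of `m`: their sum is `s.card`, and the sum of their squares
counts coincident pairs. -/
theorem card_coincidences_ge (s : Finset (ℕ × ℕ)) (m : ℕ × ℕ → ℕ) {M : ℕ} (hm : ∀ i ∈ s, m i < M) :
    (s.card : ℝ) ^ 2 ≤ M * ∑ j ∈ s, ∑ i ∈ s, if m i = m j then (1 : ℝ) else 0 := by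
  have h1 : ∑ v ∈ Finset.range M, ∑ i ∈ s, (if m i = v then (1 : ℝ) else 0) = s.card := by
    rw [Finset.sum_comm, Finset.sum_congr rfl (g := fun _ => (1 : ℝ))]
    · simp
    · intro i hi
      rw [Finset.sum_ite_eq, if_pos (Finset.mem_range.2 (hm i hi))]
  have h2 : ∑ v ∈ Finset.range M, (∑ i ∈ s, (if m i = v then (1 : ℝ) else 0)) ^ 2
      = ∑ j ∈ s, ∑ i ∈ s, if m i = m j then (1 : ℝ) else 0 := by
    simp_rw [sq, Finset.sum_mul_sum]
    rw [Finset.sum_comm]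
    conv_lhs => enter [2, i]; rw [Finset.sum_comm]
    rw [Finset.sum_comm]
    refine Finset.sum_congr rfl fun j hj => Finset.sum_congr rfl fun i hi => ?_
    have : ∀ v, (if m i = v then (1 : ℝ) else 0) * (if m j = v then 1 else 0)
        = if m i = v then (if m j = m i then 1 else 0) else 0 := by
      intro v
      by_cases h : m i = v
      · simp [h]
      · simp [h]
    simp_rw [this]
    rw [Finset.sum_ite_eq, if_pos (Finset.mem_range.2 (hm i hi))]
    simp [eq_comm]
  rw [← h1, ← h2]
  have := sq_sum_le_card_mul_sum_sq (s := Finset.range M)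
    (f := fun v => ∑ i ∈ s, (if m i = v then (1 : ℝ) else 0))
  simpa using this

/-- Lower bound for the uniform distance from an extremal function to trigonometric polynomials. -/
theorem le_of_abs_cosSum_sub_le {ψ : ℝ → ℝ} {n : ℕ} (hn : 1 ≤ n)
    (hψ : ∀ k : ℕ, 1 ≤ k → 0 < ψ k) (hanti : AntitoneOn ψ (Ici 1)) {κ : ℝ} (hκ : 0 ≤ κ)
    {t : ℝ → ℝ} (ht : t ∈ trigPoly n) {M : ℝ}
    (hM : ∀ x, |cosSum (Finset.range n ×ˢ Finset.range n)
      (fun i => κ / n * ψ ((2 * n + i.1 - i.2 : ℕ) : ℝ)) (fun i => 2 * n + i.1 - i.2) 0 x - t x| ≤ M) :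
    κ * n * ψ ((3 * n : ℕ) : ℝ) / 8 ≤ M := by
  have hn0 : (0 : ℝ) < n := by exact_mod_cast hn
  have hπ : (0 : ℝ) ≤ 2 * π := by positivity
  set s := Finset.range n ×ˢ Finset.range n with hs
  set m : ℕ × ℕ → ℕ := fun i => 2 * n + i.1 - i.2 with hm
  have hmem : ∀ i ∈ s, n ≤ m i ∧ 1 ≤ m i ∧ m i ≤ 3 * n ∧ m i < 4 * n := by
    intro i hi
    simp only [hs, Finset.mem_product, Finset.mem_range] at hi
    simp only [hm]
    omega
  set f := cosSum s (fun i => κ / n * ψ (m i)) m 0 with hf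
  change ∀ x, |f x - t x| ≤ M at hM
  have hfc : Continuous f := continuous_cosSum _ _ _ _
  have htc := continuous_of_mem_trigPoly ht
  -- The test function is the Fejér kernel modulated by `cos (2 n x)`: its `L_1` norm is at most
  -- `2π`, and it is orthogonal to `trigPoly n`.
  set g := cosSum s (fun _ => 1 / (n : ℝ)) m 0 with hg
  have hgc : Continuous g := continuous_cosSum _ _ _ _
  have hup : ∫ x in (0 : ℝ)..(2 * π), (f x - t x) * g x ≤ M * (2 * π) := by
    have h1 := integral_fejer hn 0
    rw [zero_add] at h1
    have h3 : M * (2 * π) = ∫ x in (0 : ℝ)..(2 * π), M * fejer n x := by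
      rw [intervalIntegral.integral_const_mul, h1]
    rw [h3]
    refine intervalIntegral.integral_mono_on hπ
      (((hfc.sub htc).mul hgc).intervalIntegrable _ _)
      (((continuous_fejer n).intervalIntegrable (μ := volume) _ _).const_mul _) fun x _ => ?_
    have hF := fejer_nonneg n x
    have h2 : |g x| ≤ fejer n x := by
      rw [hg, hs, hm, cosSum_shifted_eq_fejer hn, one_mul, abs_mul, abs_of_nonneg hF]
      exact mul_le_of_le_one_left hF (abs_cos_le_one _)
    refine (le_abs_self _).trans ?_
    rw [abs_mul]
    exact mul_le_mul (hM x) h2 (abs_nonneg _) ((abs_nonneg _).trans (hM x))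
  have heq : ∫ x in (0 : ℝ)..(2 * π), (f x - t x) * g x
      = π * ∑ j ∈ s, 1 / (n : ℝ) * ∑ i ∈ s, κ / n * ψ (m i) * if m i = m j then 1 else 0 := by
    simp_rw [sub_mul]
    rw [intervalIntegral.integral_sub (Continuous.intervalIntegrable (by fun_prop) _ _)
      (Continuous.intervalIntegrable (by fun_prop) _ _), hg, integral_mul_cosSum hfc, integral_mul_cosSum htc,
      Finset.sum_eq_zero (f := fun i => 1 / (n : ℝ) * fourierCos t (m i)), mul_zero, sub_zero]
    · congr 1
      refine Finset.sum_congr rfl fun j hj => ?_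
      rw [hf, fourierCos_cosSum _ fun i hi => (hmem i hi).2.1]
      simp only [cos_zero]
    · intro i hi
      rw [fourierCos_trigPoly ht (hmem i hi).1 (hmem i hi).2.1, mul_zero]
  have hlow : π * (1 / (n : ℝ) * (κ / n * ψ ((3 * n : ℕ) : ℝ)) *
      ∑ j ∈ s, ∑ i ∈ s, if m i = m j then (1 : ℝ) else 0)
      ≤ ∫ x in (0 : ℝ)..(2 * π), (f x - t x) * g x := by
    rw [heq, Finset.mul_sum]
    refine mul_le_mul_of_nonneg_left (Finset.sum_le_sum fun j hj => ?_) pi_pos.le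
    rw [mul_assoc, Finset.mul_sum]
    refine mul_le_mul_of_nonneg_left (Finset.sum_le_sum fun i hi => ?_) (by positivity)
    refine mul_le_mul_of_nonneg_right ?_ (by split_ifs <;> norm_num)
    refine mul_le_mul_of_nonneg_left ?_ (by positivity)
    obtain ⟨-, h1, h3, -⟩ := hmem i hi
    exact hanti (show (1 : ℝ) ≤ (m i : ℝ) by exact_mod_cast h1)
      (show (1 : ℝ) ≤ ((3 * n : ℕ) : ℝ) by exact_mod_cast h1.trans h3) (by exact_mod_cast h3)
  have hcard := card_coincidences_ge s m fun i hi => (hmem i hi).2.2.2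
  generalize ∑ j ∈ s, ∑ i ∈ s, (if m i = m j then (1 : ℝ) else 0) = R at hlow hcard
  have hsc : (s.card : ℝ) = n * n := by rw [hs, Finset.card_product]; simp
  rw [hsc] at hcard
  push_cast at hcard
  -- There are `n²` pairs and all frequencies are below `4 n`, so coincidences number at least `n⁴ /
  -- (4 n)`.
  have hR : (n : ℝ) ^ 3 / 4 ≤ R := by
    refine le_of_mul_le_mul_left ?_ (show (0 : ℝ) < 4 * n by positivity)
    linarith [show 4 * (n : ℝ) * ((n : ℝ) ^ 3 / 4) = (n * n) ^ 2 by ring]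
  have hψ3 := hψ (3 * n) (by omega)
  have h5 : π * (1 / (n : ℝ) * (κ / n * ψ ((3 * n : ℕ) : ℝ)) * ((n : ℝ) ^ 3 / 4))
      ≤ π * (1 / (n : ℝ) * (κ / n * ψ ((3 * n : ℕ) : ℝ)) * R) := by gcongr
  have h6 : π * (1 / (n : ℝ) * (κ / n * ψ ((3 * n : ℕ) : ℝ)) * ((n : ℝ) ^ 3 / 4))
      = π * 2 * (κ * n * ψ ((3 * n : ℕ) : ℝ) / 8) := by field_simp; ring
  refine le_of_mul_le_mul_left ?_ (show 0 < π * 2 by positivity)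
  linarith

theorem bigO_bestApprox {ψ : ℝ → ℝ} {p β : ℝ} (hp : 1 ≤ p) (hMC : gfun ψ (1 / p) ∈ MC) :
    BigO (fun n => ENNReal.ofReal (ψ n * (n : ℝ) ^ (1 / p)))
      (fun n => bestApprox (classC ψ β p) n) := by
  have hψ : ∀ k : ℕ, 1 ≤ k → 0 < ψ k := fun k hk => psi_pos hMC.1 (by exact_mod_cast hk)
  have hp0 : 0 < p := by linarith
  have hanti := psi_antitoneOn (by positivity) hMC.1
  obtain ⟨c, hc, hc3⟩ := psi_three_mul_ge hMC
  set A : ℝ := (2 ^ (p - 1) * (2 * π)) ^ (-(1 / p)) with hA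
  have hA0 : 0 < A := by positivity
  have hK : 0 < 8 / (A * c) := by positivity
  refine ⟨Real.toNNReal (8 / (A * c)), by simpa using hK, fun n hn => ?_⟩
  have hn0 : (0 : ℝ) < n := by exact_mod_cast hn
  set κ : ℝ := ((2 * n) ^ (p - 1) * (2 * π)) ^ (-(1 / p)) with hκ
  have hκ0 : 0 < κ := by positivity
  -- The normalising factor scales as `n ^ (1 / p - 1)`; `A` is its part free of `n`.
  have hκA : κ * n = A * (n : ℝ) ^ (1 / p) := by
    rw [hκ, hA, mul_rpow (by norm_num) hn0.le, mul_right_comm, mul_rpow (by positivity) (by positivity),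
      ← rpow_mul hn0.le, mul_assoc]
    congr 1
    nth_rewrite 2 [← rpow_one (n : ℝ)]
    rw [← rpow_add hn0]
    congr 1
    field_simp; ring
  have hκp : κ ^ p * ((2 * n) ^ (p - 1) * (2 * π)) ≤ 1 := by
    rw [hκ, ← rpow_mul (by positivity), neg_mul, one_div_mul_cancel hp0.ne', rpow_neg_one,
      inv_mul_cancel₀ (by positivity)]
  set s := Finset.range n ×ˢ Finset.range n with hs
  set m : ℕ × ℕ → ℕ := fun i => 2 * n + i.1 - i.2 with hm
  have hmem : ∀ i ∈ s, 1 ≤ m i := by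
    intro i hi
    simp only [hs, Finset.mem_product, Finset.mem_range] at hi
    simp only [hm]
    omega
  have hF : cosSum s (fun i => κ / n * ψ (m i)) m 0 ∈ classC ψ β p :=
    ⟨⟨cosSum_mem_L1per _ _ _ _, _, cosSum_shifted_mem_unitBall hn hp hκ0.le hκp (β * π / 2),
      isPsiBetaDeriv_cosSum (fun _ => κ / n) hmem hψ⟩, continuous_cosSum _ _ _ _⟩
  set V : ℝ := κ * n * ψ ((3 * n : ℕ) : ℝ) / 8 with hV
  have hdist : ENNReal.ofReal V ≤ bestApprox (classC ψ β p) n := by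
    refine le_iSup₂_of_le _ hF (le_iInf₂ fun t ht => ?_)
    -- The contradiction hypothesis makes the norm finite, so that its `toReal` is an honest
    -- pointwise bound.
    by_contra! hlt
    have hfin : normC (fun x => cosSum s (fun i => κ / n * ψ (m i)) m 0 x - t x) ≠ ⊤ :=
      (hlt.trans ENNReal.ofReal_lt_top).ne
    have h1 := le_of_abs_cosSum_sub_le hn hψ hanti hκ0.le ht
      (M := (normC (fun x => cosSum s (fun i => κ / n * ψ (m i)) m 0 x - t x)).toReal) fun x => by
        rw [← ENNReal.ofReal_le_iff_le_toReal hfin]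
        exact le_iSup (fun x => ENNReal.ofReal |cosSum s (fun i => κ / n * ψ (m i)) m 0 x - t x|) x
    exact absurd (ENNReal.ofReal_le_of_le_toReal h1) (not_le.2 hlt)
  calc ENNReal.ofReal (ψ n * (n : ℝ) ^ (1 / p)) ≤ ENNReal.ofReal (8 / (A * c) * V) := by
        refine ENNReal.ofReal_le_ofReal ?_
        rw [hV, hκA]
        calc ψ n * (n : ℝ) ^ (1 / p) = 8 / (A * c) * (A * (n : ℝ) ^ (1 / p) * (c * ψ n) / 8) := by
              field_simp
          _ ≤ _ := by gcongr; exact hc3 n hn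
    _ = ENNReal.ofReal (8 / (A * c)) * ENNReal.ofReal V := ENNReal.ofReal_mul hK.le
    _ ≤ ENNReal.ofReal (8 / (A * c)) * bestApprox (classC ψ β p) n := by gcongr

/-! ### Closing the cycle of estimates. -/

theorem bestApprox_le_zygmundDev (F : Set (ℝ → ℝ)) (s : ℝ) (n : ℕ) :
    bestApprox F n ≤ zygmundDev F s n := by
  refine iSup₂_mono fun f _ => iInf₂_le_of_le (zygmundSum s n f) ?_ le_rfl
  -- The constant term is undamped, and `s` is arbitrary here, so index `0` is treated separately.
  refine ⟨fun k => if k = 0 then fourierCos f 0 else (1 - ((k : ℝ) / n) ^ s) * fourierCos f k,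
    fun k => (1 - ((k : ℝ) / n) ^ s) * fourierSin f k, fun x => ?_⟩
  simp only [zygmundSum, if_true]
  congr 1
  refine Finset.sum_congr rfl fun k hk => ?_
  have : k ≠ 0 := by have := (Finset.mem_Ico.1 hk).1; omega
  rw [if_neg this]; ring

theorem BigO.trans {A B C : ℕ → ℝ≥0∞} (h : BigO A B) (h' : BigO B C) : BigO A C := by
  obtain ⟨K, hK, h⟩ := h
  obtain ⟨K', hK', h'⟩ := h'
  refine ⟨K * K', by positivity, fun n hn => (h n hn).trans ?_⟩
  rw [ENNReal.coe_mul, mul_assoc]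
  gcongr
  exact h' n hn

theorem orderEq_of_bigO_cycle {A B C : ℕ → ℝ≥0∞} (hAB : BigO A B) (hBC : BigO B C)
    (hCA : BigO C A) : OrderEq A B ∧ OrderEq B C :=
  ⟨⟨hAB, hBC.trans hCA⟩, hBC, hCA.trans hAB⟩

theorem bigO_bestApprox_zygmundDev (F : Set (ℝ → ℝ)) (s : ℝ) :
    BigO (fun n => bestApprox F n) (fun n => zygmundDev F s n) :=
  ⟨1, one_pos, fun n _ => by simpa using bestApprox_le_zygmundDev F s n⟩

end ZygmundApprox

theorem theorem2 (ψ : ℝ → ℝ) (s p β : ℝ) (hs : 0 < s) (hp : 1 ≤ p)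
    (hMC : ZygmundApprox.gfun ψ (1 / p) ∈ ZygmundApprox.MC)
    (hGM : (fun k : ℕ => ZygmundApprox.gfun ψ (s + 1 / p) k) ∈ ZygmundApprox.GMplus)
    (hGA : (fun k : ℕ => ZygmundApprox.gfun ψ (s + 1 / p) k) ∈ ZygmundApprox.GAplus) :
    (1 < p → ∀ p' : ℝ, 1 / p + 1 / p' = 1 →
      Summable (fun k : ℕ => ψ ((k + 1 : ℕ) : ℝ) ^ p' * ((k + 1 : ℕ) : ℝ) ^ (p' - 2)) →
      p' / 2 < (⨅ t : Set.Ici (1 : ℝ),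
        ZygmundApprox.alpha (ZygmundApprox.gfun ψ (1 / p)) (t : ℝ)) →
      ZygmundApprox.OrderEq
          (fun n => ZygmundApprox.bestApprox (ZygmundApprox.classC ψ β p) n)
          (fun n => ZygmundApprox.zygmundDev (ZygmundApprox.classC ψ β p) s n) ∧
        ZygmundApprox.OrderEq
          (fun n => ZygmundApprox.zygmundDev (ZygmundApprox.classC ψ β p) s n)
          (fun n => ENNReal.ofReal (ψ n * (n : ℝ) ^ (1 / p)))) ∧
    (p = 1 →
      Summable (fun k : ℕ => ψ ((k + 1 : ℕ) : ℝ)) →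
      1 < (⨅ t : Set.Ici (1 : ℝ),
        ZygmundApprox.alpha (ZygmundApprox.gfun ψ 1) (t : ℝ)) →
      ZygmundApprox.OrderEq
          (fun n => ZygmundApprox.bestApprox (ZygmundApprox.classC ψ β 1) n)
          (fun n => ZygmundApprox.zygmundDev (ZygmundApprox.classC ψ β 1) s n) ∧
        ZygmundApprox.OrderEq
          (fun n => ZygmundApprox.zygmundDev (ZygmundApprox.classC ψ β 1) s n)
          (fun n => ENNReal.ofReal (ψ n * (n : ℝ)))) := by
  refine ⟨fun hp1 p' hp' _ _ => ?_, fun hp1 _ _ => ?_⟩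
  · have hpq : p.HolderConjugate p' :=
      Real.holderConjugate_iff.2 ⟨hp1, by simpa using hp'⟩
    exact ZygmundApprox.orderEq_of_bigO_cycle (ZygmundApprox.bigO_bestApprox_zygmundDev _ s)
      (ZygmundApprox.bigO_zygmundDev_of_one_lt hs hpq hMC hGA)
      (ZygmundApprox.bigO_bestApprox hp hMC)
  · subst hp1
    have hlow := ZygmundApprox.bigO_bestApprox (β := β) hp hMC
    simp only [div_one] at hMC hGA hlow
    have hup := ZygmundApprox.bigO_zygmundDev_one (β := β) hs hMC hGA
    simp only [Real.rpow_one] at hlow hup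
    exact ZygmundApprox.orderEq_of_bigO_cycle (ZygmundApprox.bigO_bestApprox_zygmundDev _ s)
      hup hlow
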